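/- Write $\mathbb T=\mathbb R/\mathbb Z$. For $|z|^2+|w|^2=1$ let $\{z,w\}\in SU(2)$ be the matrix with first row $(z,w)$; an element of $su(2)$ with first row $(z,w)$ is also written $\{z,w\}$. Let $|x|_{\mathbb Z/2}$ be the distance from $x$ to $\tfrac12\mathbb Z$, let $[x]_{\mathbb Z/2}$ be the representative of $x$ modulo $\tfrac12\mathbb Z$ closest to $0$, and let $\|\cdot\|_0$ be the supremum norm on $\mathbb T$. For a sequence of integers $(k_i)_{i\ge0}$, $u_i=O(|k_i|^{-\infty})$ means that $|k_i|^N |u_i|$ is bounded in $i$ for every $N$. Let $\alpha\in\mathbb R$ be Diophantine, i.e. there are $\gamma>0$ and $\tau$ with $|q\alpha|_{\mathbb Z}\ge\gamma|q|^{-\tau}$ for all integers $q\ne0$. A cocycle $(\alpha,Ae^{F(\cdot)})$ with $F\in C^\infty(\mathbb T,su(2))$ acts on $\mathbb T\times SU(2)$ by $(x,S)\mapsto(x+\alpha,Ae^{F(x)}S)$; it is *transitive* if it has a dense (forward) orbit. It is *in KAM normal form*, with data $k_i\in\mathbb Z$, $a_i,a_\infty,\theta_i,\varphi_i\in\mathbb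 R$, $F_i\in C^\infty(\mathbb T,su(2))$, $s_i\in\mathbb N$ ($i\ge0$), if $A=A_0$ and $F=F_0$, where $A_i=\{e^{2i\pi a_i},0\}$, and the following hold. 1. With $B_i(x)=\{e^{2i\pi k_ix},0\}$, $D_i=\{\cos\frac{\theta_i}2,\,e^{2i\pi\varphi_i}\sin\frac{\theta_i}2\}$ and $G_i=B_iD_iB_i^*$, $$G_i(x+\alpha)A_ie^{F_i(x)}G_i(x)^*=A_{i+1}e^{F_{i+1}(x)}\qquad(i\ge0,\ x\in\mathbb T).$$ 2. $A_i\to\{e^{2i\pi a_\infty},0\}$; $\|\partial^rF_i\|_0=O(|k_i|^{-\infty})$ for every $r\ge0$; $s_i\to\infty$ and $|k_{i+1}|>|k_i|^{s_i}$; and $|a_i-k_i\alpha|_{\mathbb Z/2}=O(|k_i|^{-\infty})$. 3. Let $2i\pi f_i$ be the Fourier coefficient of frequency $2k_i$ of the upper right entry of $F_i$ (so that the resonant mode of $F_i$ is $\{0,2i\pi f_ie^{2i\pi(2k_i)x}\}$). Then $f_i\ne0$, and there is a sequence $\eta_i=O(|k_i|^{-\infty})$ such that every other Fourier coefficient of frequency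 $q$, $|q|\le|k_i|^{s_i}$, of the entries of the first row of $F_i$ is bounded in modulus by $\eta_i|f_i|$. 4. $\theta_i\in[-\frac\pi2,\frac\pi2]$, and there are real $\delta_i=O(|k_i|^{-\infty})$ and complex $\delta_i'=O(|k_i|^{-\infty})$ with $$[a_i-k_i\alpha]_{\mathbb Z/2}\,\sin\theta_i=(1+\delta_i)|f_i|\cos\theta_i,\qquad e^{2i\pi\varphi_i}=(1+\delta_i')\frac{f_i}{|f_i|},$$ that is, $\tan\theta_i=|f_i|/[a_i-k_i\alpha]_{\mathbb Z/2}$ and $e^{2i\pi\varphi_i}=f_i/|f_i|$ up to relative errors $O(|k_i|^{-\infty})$. Put $H_i=G_i\cdots G_1G_0$ and $P_i=D_i\cdots D_1D_0=H_i(0)$. **Proposition.** Let $\alpha$ be Diophantine and let $(\alpha,Ae^{F(\cdot)})$ be a cocycle in KAM normal form as above. Suppose that there are $n_l\in\mathbb N$, $\varepsilon>0$ and $i_l\to\infty$ such that, as $l\to\infty$, $$n_l\alpha\to0\ \text{in }\mathbb T,\qquad \liminf_l|n_la_\infty|_{\mathbb Z/2}\ge\varepsilon,\qquad H_{i_l}(n_l\alpha)P_{i_l}^*\to\mathrm{Id},\qquad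 n_l\|F_{i_l+1}\|_0\to0,$$ and that the sequence $(P_i)$ has at least two distinct accumulation points in $SO(3)\equiv SU(2)/\{\pm\mathrm{Id}\}$. Then the cocycle $(\alpha,Ae^{F(\cdot)})$ is transitive on $\mathbb T\times SU(2)$. -/

import Mathlib

open Filter Topology
open scoped Matrix.Norms.L2Operator ContDiff

noncomputable section

/-- The group `SU(2)`, with the topology induced from `2 × 2` complex matrices. -/
abbrev SU2 : Type := Matrix.specialUnitaryGroup (Fin 2) ℂ

/-- The Lie algebra `su(2)`: skew-Hermitian traceless `2 × 2` matrices, with the operator norm. -/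
def su2 : Submodule ℝ (Matrix (Fin 2) (Fin 2) ℂ) where
  carrier := {X | star X = -X ∧ X.trace = 0}
  add_mem' := by
    rintro X Y ⟨hX, hX'⟩ ⟨hY, hY'⟩
    refine ⟨?_, ?_⟩
    · rw [star_add, hX, hY, neg_add]
    · rw [Matrix.trace_add, hX', hY', add_zero]
  zero_mem' := by simp
  smul_mem' := by
    rintro c X ⟨hX, hX'⟩
    refine ⟨?_, ?_⟩
    · rw [star_smul, hX, smul_neg, star_trivial]
    · rw [Matrix.trace_smul, hX', smul_zero]

theorem exp_mem_SU2 (X : su2) :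
    NormedSpace.exp (X : Matrix (Fin 2) (Fin 2) ℂ) ∈ Matrix.specialUnitaryGroup (Fin 2) ℂ := by
  obtain ⟨X, hX, hT⟩ := X
  have h1 : NormedSpace.exp (-X) * NormedSpace.exp X = 1 := by
    rw [← Matrix.exp_add_of_commute _ _ (Commute.neg_left (Commute.refl X)), neg_add_cancel,
      NormedSpace.exp_zero]
  rw [Matrix.mem_specialUnitaryGroup_iff]
  refine ⟨?_, ?_⟩
  · rw [Matrix.mem_unitaryGroup_iff', Matrix.star_eq_conjTranspose, ← Matrix.exp_conjTranspose,
      ← Matrix.star_eq_conjTranspose]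
    change NormedSpace.exp (star X) * NormedSpace.exp X = 1
    rw [hX, h1]
  have hT' : X 1 1 = -X 0 0 := by
    rw [Matrix.trace_fin_two] at hT
    linear_combination hT
  let J : (Matrix (Fin 2) (Fin 2) ℂ)ˣ :=
    ⟨!![0, 1; -1, 0], !![0, -1; 1, 0],
      by ext i j; fin_cases i <;> fin_cases j <;> simp,
      by ext i j; fin_cases i <;> fin_cases j <;> simp⟩
  have hadj : ∀ Y : Matrix (Fin 2) (Fin 2) ℂ,
      (J : Matrix (Fin 2) (Fin 2) ℂ) * Y.transpose * (J⁻¹).1 = Y.adjugate := by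
    intro Y
    change !![0, 1; -1, 0] * Y.transpose * !![0, -1; 1, 0] = _
    rw [Matrix.adjugate_fin_two, Matrix.eta_fin_two Y.transpose]
    simp
  have hX' : X.adjugate = -X := by
    rw [Matrix.adjugate_fin_two]
    ext i j
    fin_cases i <;> fin_cases j <;> simp [hT']
  have hE : (NormedSpace.exp X).adjugate = NormedSpace.exp (-X) := by
    rw [← hadj, ← Matrix.exp_transpose, ← Matrix.exp_units_conj, hadj, hX']
  rw [← hE, Matrix.adjugate_mul] at h1
  have := congrFun (congrFun h1 0) 0
  simpa using this

/-- The exponential map `su(2) → SU(2)`. -/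
def expSU2 (X : su2) : SU2 := ⟨NormedSpace.exp (X : Matrix (Fin 2) (Fin 2) ℂ), exp_mem_SU2 X⟩

/-- The matrix `{z, w}` of `SU(2)`, whose first row is `(z, w)`. -/
def mkSU2 (z w : ℂ) (h : Complex.normSq z + Complex.normSq w = 1) : SU2 :=
  ⟨!![z, w; -(starRingEnd ℂ) w, (starRingEnd ℂ) z], by
    have h' : z * (starRingEnd ℂ) z + w * (starRingEnd ℂ) w = 1 := by
      rw [Complex.mul_conj, Complex.mul_conj]
      exact_mod_cast h
    rw [Matrix.mem_specialUnitaryGroup_iff, Matrix.mem_unitaryGroup_iff]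
    refine ⟨?_, ?_⟩
    · ext i j
      fin_cases i <;> fin_cases j <;>
        simp [Matrix.mul_apply, Fin.sum_univ_two, Matrix.star_apply]
      · exact h'
      · ring
      · ring
      · linear_combination h'
    · rw [Matrix.det_fin_two_of]
      linear_combination h'⟩

/-- The complex number `e^{2 i π t}`. -/
def e2pi (t : ℝ) : ℂ := Complex.exp (2 * Real.pi * t * Complex.I)

theorem normSq_e2pi (t : ℝ) : Complex.normSq (e2pi t) = 1 := by
  have h : e2pi t = Complex.exp ((2 * Real.pi * t : ℝ) * Complex.I) := by
    simp [e2pi]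
  rw [Complex.normSq_eq_norm_sq, h, Complex.norm_exp_ofReal_mul_I, one_pow]

/-- The diagonal matrix `{e^{2 i π t}, 0}`. -/
def diagSU2 (t : ℝ) : SU2 := mkSU2 (e2pi t) 0 (by rw [normSq_e2pi, map_zero, add_zero])

/-- The matrix `{cos (θ / 2), e^{2 i π φ} sin (θ / 2)}`. -/
def angleMatrix (θ φ : ℝ) : SU2 :=
  mkSU2 (Real.cos (θ / 2) : ℝ) (e2pi φ * (Real.sin (θ / 2) : ℝ)) (by
    rw [Complex.normSq_mul, normSq_e2pi, Complex.normSq_ofReal, Complex.normSq_ofReal, one_mul]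
    nlinarith [Real.sin_sq_add_cos_sq (θ / 2)])

/-- The representative of `x` modulo `ℤ / 2` that is closest to `0`;
its absolute value is `|x|_{mod ℤ / 2}`. -/
def modHalf (x : ℝ) : ℝ := x - (round (2 * x) : ℝ) / 2

/-- The Diophantine condition: `|q α|_{mod ℤ} ≥ γ / |q| ^ τ` for all integers `q ≠ 0`,
for some `γ > 0` and some `τ`. -/
def IsDiophantine (α : ℝ) : Prop :=
  ∃ γ τ : ℝ, 0 < γ ∧ ∀ q : ℤ, q ≠ 0 → γ / |(q : ℝ)| ^ τ ≤ |q * α - round (q * α)|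

/-- `u i = O(|k i| ^ {-∞})`: for every `N`, `|k i| ^ N * u i` is bounded (for `u ≥ 0`). -/
def IsBigOInfty (k : ℕ → ℤ) (u : ℕ → ℝ) : Prop :=
  ∀ N : ℕ, ∃ C : ℝ, ∀ i, |(k i : ℝ)| ^ N * u i ≤ C

/-- The `q`-th Fourier coefficient of the entry `(a, b)` of a `1`-periodic `su(2)`-valued map. -/
def entryCoeff (F : ℝ → su2) (q : ℤ) (a b : Fin 2) : ℂ :=
  ∫ x in (0 : ℝ)..1, e2pi (-(q * x)) * (F x : Matrix (Fin 2) (Fin 2) ℂ) a b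

/-- The coefficient `f` of the resonant mode `{0, 2 i π f e^{2 i π (2 k) x}}` of `F`. -/
def resCoeff (F : ℝ → su2) (k : ℤ) : ℂ :=
  entryCoeff F (2 * k) 0 1 / (2 * Real.pi * Complex.I)

/-- The conjugation `x ↦ B(x) D B(x)^*`, where `B(x) = {e^{2 i π k x}, 0}` and
`D = {cos (θ / 2), e^{2 i π φ} sin (θ / 2)}`. -/
def resConj (k : ℤ) (θ φ : ℝ) (x : ℝ) : SU2 :=
  diagSU2 (k * x) * angleMatrix θ φ * star (diagSU2 (k * x))

/-- A cocycle over the rotation by `α`, in KAM normal form: the cocycle itself is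
`(α, A_0 e^{F_0})`, and the conjugations `G_i = B_i D_i B_i^*` reduce successively the resonant
modes `k_i`, conjugating `(α, A_i e^{F_i})` to `(α, A_{i+1} e^{F_{i+1}})`,
with `A_i = {e^{2 i π a_i}, 0}`. -/
structure KAMNormalForm (α : ℝ) where
  /-- the resonances -/
  k : ℕ → ℤ
  /-- the arguments of the diagonal constants `A_i` -/
  a : ℕ → ℝ
  /-- the argument of the limit `A_∞` -/
  aInf : ℝ
  /-- the angles -/
  θ : ℕ → ℝ
  /-- the phases -/
  φ : ℕ → ℝ
  /-- the perturbations -/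
  F : ℕ → ℝ → su2
  /-- the exponents of the growing powers of `|k_i|` -/
  s : ℕ → ℕ
  smooth : ∀ i, ContDiff ℝ ∞ (F i)
  periodic : ∀ i, Function.Periodic (F i) 1
  conj : ∀ i x, resConj (k i) (θ i) (φ i) (x + α) * (diagSU2 (a i) * expSU2 (F i x)) *
    star (resConj (k i) (θ i) (φ i) x) = diagSU2 (a (i + 1)) * expSU2 (F (i + 1) x)
  tendsto_A : Tendsto (fun i => diagSU2 (a i)) atTop (𝓝 (diagSU2 aInf))
  /-- `F_i = O(|k_i| ^ {-∞})` in `C^∞` -/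
  small : ∀ r : ℕ, IsBigOInfty k (fun i => ⨆ x, ‖iteratedDeriv r (F i) x‖)
  tendsto_s : Tendsto s atTop atTop
  growth : ∀ i, |k i| ^ s i < |k (i + 1)|
  resonant : IsBigOInfty k (fun i => |modHalf (a i - k i * α)|)
  active : ∀ i, resCoeff (F i) (k i) ≠ 0
  /-- up to the order `|k_i| ^ {s_i}`, only the resonant mode of `F_i` is active -/
  inactive : ∃ η : ℕ → ℝ, IsBigOInfty k η ∧ ∀ i, ∀ q : ℤ, |q| ≤ |k i| ^ s i →
    ‖entryCoeff (F i) q 0 0‖ ≤ η i * ‖resCoeff (F i) (k i)‖ ∧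
    (q ≠ 2 * k i → ‖entryCoeff (F i) q 0 1‖ ≤ η i * ‖resCoeff (F i) (k i)‖)
  θ_mem : ∀ i, θ i ∈ Set.Icc (-(Real.pi / 2)) (Real.pi / 2)
  /-- `tan θ_i = |f_i| / (a_i - k_i α)`, up to a factor `1 + O(|k_i| ^ {-∞})` -/
  angle : ∃ δ : ℕ → ℝ, IsBigOInfty k (fun i => |δ i|) ∧ ∀ i,
    modHalf (a i - k i * α) * Real.sin (θ i) =
      (1 + δ i) * ‖resCoeff (F i) (k i)‖ * Real.cos (θ i)
  /-- `e^{2 i π φ_i} = f_i / |f_i|`, up to a factor `1 + O(|k_i| ^ {-∞})` -/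
  phase : ∃ δ : ℕ → ℂ, IsBigOInfty k (fun i => ‖δ i‖) ∧ ∀ i,
    e2pi (φ i) = (1 + δ i) * (resCoeff (F i) (k i) / (‖resCoeff (F i) (k i)‖ : ℝ))

namespace KAMNormalForm

variable {α : ℝ} (K : KAMNormalForm α)

/-- The conjugations `G_i`. -/
def G (i : ℕ) (x : ℝ) : SU2 := resConj (K.k i) (K.θ i) (K.φ i) x

/-- The matrices `D_i`. -/
def D (i : ℕ) : SU2 := angleMatrix (K.θ i) (K.φ i)

/-- The products `H_i = G_i ⋯ G_1 G_0`. -/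
def H : ℕ → ℝ → SU2
  | 0, x => K.G 0 x
  | i + 1, x => K.G (i + 1) x * H i x

/-- The products `D_i ⋯ D_1 D_0`. -/
def prodD : ℕ → SU2
  | 0 => K.D 0
  | i + 1 => K.D (i + 1) * prodD i

/-- The map `x ↦ A e^{F(x)}` on `ℝ`, where `A = A_0` and `F = F_0`. -/
def map (x : ℝ) : SU2 := diagSU2 (K.a 0) * expSU2 (K.F 0 x)

theorem map_periodic : Function.Periodic K.map 1 := fun x => by
  unfold map
  rw [K.periodic 0 x]

/-- The fibered map of the cocycle `(α, A e^F)`: `(x, S) ↦ (x + α, A e^{F(x)} S)`. -/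
def cocycle (p : UnitAddCircle × SU2) : UnitAddCircle × SU2 :=
  (p.1 + (α : UnitAddCircle), K.map_periodic.lift p.1 * p.2)

end KAMNormalForm

/-- The subgroup `{Id, -Id}` of `SU(2)`. -/
def plusMinusOne : Subgroup SU2 where
  carrier := {S | (S : Matrix (Fin 2) (Fin 2) ℂ) = 1 ∨ (S : Matrix (Fin 2) (Fin 2) ℂ) = -1}
  mul_mem' := by
    rintro S T (hS | hS) (hT | hT)
    · exact Or.inl (by rw [Submonoid.coe_mul, hS, hT, one_mul])
    · exact Or.inr (by rw [Submonoid.coe_mul, hS, hT, one_mul])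
    · exact Or.inr (by rw [Submonoid.coe_mul, hS, hT, mul_one])
    · exact Or.inl (by rw [Submonoid.coe_mul, hS, hT, neg_mul_neg, one_mul])
  one_mem' := Or.inl rfl
  inv_mem' := by
    rintro S (hS | hS)
    · exact Or.inl (by rw [← Matrix.star_eq_inv, Matrix.specialUnitaryGroup.coe_star, hS, star_one])
    · exact Or.inr (by
        rw [← Matrix.star_eq_inv, Matrix.specialUnitaryGroup.coe_star, hS, star_neg, star_one])

/-- `SO(3) ≡ SU(2) mod ± Id`, with the quotient topology. -/
abbrev SO3 : Type := SU2 ⧸ plusMinusOne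

/-- A map is transitive if it has a dense (forward) orbit. -/
def IsTransitiveMap {X : Type*} [TopologicalSpace X] (T : X → X) : Prop :=
  ∃ p : X, Dense (Set.range fun n : ℕ => T^[n] p)

end

/-!
The fibers of a minimal set `Y` of the cocycle are cosets of a closed subgroup `Γ` of `SU(2)`, the
group of the right translations that preserve `Y`, because a translate of a minimal set is again
minimal (`inv_mul_mem_rightStabilizer`). The cocycle is transitive, and even minimal, once
`Γ = SU(2)`; this is shown by exhibiting in `Γ` two different maximal tori.

*Tori in `Γ`.* The iterates of the cocycle are `H_i(x + n α)^* (A_{i+1}^n + o(1)) H_i(x)` as long as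
`n ‖F_{i+1}‖₀` is small. As `α` is Diophantine, there is, for every real `s`, a time `n` which is
polynomial in `|k_{i+1}|` and satisfies `n α ≈ s / k_{i+1}` modulo `ℤ`. This is so small compared
with the inverses of the frequencies `k_0, …, k_i` that `H_i(x + n α) ≈ H_i(x)`, while
`a_{i+1} ≈ k_{i+1} α` modulo `ℤ / 2` yields `A_{i+1}^n ≈ {e^{2 i π s}, 0}` if `n` is even. Hence the
fibered part of the `n`-th iterate is close to `H_i(x)^* {e^{2 i π s}, 0} H_i(x)`, uniformly in `x`
(`KAMNormalForm.exists_iter_near`), and the limits of these matrices, at points of `Y` that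
converge as `i → ∞`, preserve the fibers of `Y` (`KAMNormalForm.conj_diagSU2_mul_mem`).

*Two different tori.* If `∑ |θ_i|` were finite, the products `D_i ⋯ D_0` would converge, which two
accumulation points exclude (`KAMNormalForm.not_summable_abs_θ`). So `∑ |θ_i| = ∞`, and since the
`k_i` are strongly lacunary, the phases of `G_{i+1}, …, G_{i'}` can be prescribed at a suitable
point `x`, in such a way that these rotations have nearly the same axis and that their angles add
up to some `Θ ∈ [π / 4, 3 π / 4]` (`KAMNormalForm.exists_dist_H_angleMatrix_mul_H_le`). Then the
tori obtained from `H_i(x)` and from `H_{i'}(x)` have limits whose axes differ by the angle `Θ`,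
and two such tori generate `SU(2)` (`subgroup_eq_top_of_two_tori`).
-/

/-! ### The group `SU(2)` as a compact group with a bi-invariant distance -/

namespace SU2

theorem dist_eq (S T : SU2) :
    dist S T = ‖(S : Matrix (Fin 2) (Fin 2) ℂ) - (T : Matrix (Fin 2) (Fin 2) ℂ)‖ := by
  rw [Subtype.dist_eq, dist_eq_norm]

theorem mem_unitary (S : SU2) :
    (S : Matrix (Fin 2) (Fin 2) ℂ) ∈ unitary (Matrix (Fin 2) (Fin 2) ℂ) :=
  (Matrix.mem_specialUnitaryGroup_iff.1 S.2).1

theorem dist_mul_left (R S T : SU2) : dist (R * S) (R * T) = dist S T := by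
  rw [dist_eq, dist_eq, Submonoid.coe_mul, Submonoid.coe_mul, ← mul_sub]
  exact CStarRing.norm_coe_unitary_mul ⟨_, mem_unitary R⟩ _

theorem dist_mul_right (R S T : SU2) : dist (S * R) (T * R) = dist S T := by
  rw [dist_eq, dist_eq, Submonoid.coe_mul, Submonoid.coe_mul, ← sub_mul]
  exact CStarRing.norm_mul_coe_unitary _ ⟨_, mem_unitary R⟩

theorem dist_mul_mul_le (R R' S S' : SU2) :
    dist (R * S) (R' * S') ≤ dist R R' + dist S S' := by
  refine (dist_triangle _ (R' * S) _).trans ?_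
  rw [dist_mul_left, dist_mul_right]

theorem dist_star_star (S T : SU2) : dist (star S) (star T) = dist S T := by
  rw [Matrix.star_eq_inv, Matrix.star_eq_inv, ← dist_mul_left S, ← dist_mul_right T]
  simp [dist_comm]

instance : ContinuousInv SU2 :=
  ⟨by
    have : Isometry (fun S : SU2 => S⁻¹) := Isometry.of_dist_eq fun S T => by
      simpa only [Matrix.star_eq_inv] using dist_star_star S T
    exact this.continuous⟩

instance : IsTopologicalGroup SU2 := { }

instance : CompactSpace SU2 := by
  have hc : IsClosed (Matrix.specialUnitaryGroup (Fin 2) ℂ : Set (Matrix (Fin 2) (Fin 2) ℂ)) := by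
    have h : (Matrix.specialUnitaryGroup (Fin 2) ℂ : Set (Matrix (Fin 2) (Fin 2) ℂ)) =
        {A | star A * A = 1} ∩ {A | A.det = 1} := by
      ext A
      simp only [SetLike.mem_coe, Matrix.mem_specialUnitaryGroup_iff, Matrix.mem_unitaryGroup_iff',
        Set.mem_inter_iff, Set.mem_ofPred_eq]
    rw [h]
    exact (isClosed_eq (by fun_prop) continuous_const).inter
      (isClosed_eq (Continuous.matrix_det continuous_id) continuous_const)
  have hb : Bornology.IsBounded
      (Matrix.specialUnitaryGroup (Fin 2) ℂ : Set (Matrix (Fin 2) (Fin 2) ℂ)) :=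
    (Metric.isBounded_iff_subset_closedBall 0).2 ⟨1, fun A hA => by
      simpa using (CStarRing.norm_of_mem_unitary (mem_unitary ⟨A, hA⟩)).le⟩
  exact isCompact_iff_compactSpace.1 (Metric.isCompact_of_isClosed_isBounded hc hb)

theorem exists_eq_mkSU2 (S : SU2) : ∃ z w h, S = mkSU2 z w h := by
  obtain ⟨A, hA⟩ := S
  obtain ⟨h1, h2⟩ := Matrix.mem_specialUnitaryGroup_iff.1 hA
  have h3 : star A = A.adjugate := by
    have h4 := Matrix.mem_unitaryGroup_iff'.1 h1
    calc star A = star A * (A * A.adjugate) := by rw [Matrix.mul_adjugate, h2, one_smul, mul_one]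
      _ = A.adjugate := by rw [← mul_assoc, h4, one_mul]
  rw [Matrix.adjugate_fin_two] at h3
  have e1 := congrFun (congrFun h3 0) 0
  have e2 := congrFun (congrFun h3 1) 0
  simp only [Matrix.star_apply, Matrix.of_apply, Matrix.cons_val', Matrix.cons_val_zero,
    Matrix.cons_val_one, Matrix.cons_val_fin_one, RCLike.star_def] at e1 e2
  have e3 : A 1 0 = -(starRingEnd ℂ) (A 0 1) := by rw [e2, neg_neg]
  refine ⟨A 0 0, A 0 1, ?_, ?_⟩
  · rw [Matrix.det_fin_two, e3, ← e1] at h2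
    have : ((Complex.normSq (A 0 0) + Complex.normSq (A 0 1) : ℝ) : ℂ) = 1 := by
      push_cast
      rw [← Complex.mul_conj, ← Complex.mul_conj, ← h2]
      ring
    exact_mod_cast this
  · apply Subtype.ext
    change A = !![A 0 0, A 0 1; -(starRingEnd ℂ) (A 0 1), (starRingEnd ℂ) (A 0 0)]
    rw [← e3, e1]
    exact Matrix.eta_fin_two A

theorem mkSU2_congr {z w z' w' : ℂ} {h h'} (hz : z = z') (hw : w = w') :
    mkSU2 z w h = mkSU2 z' w' h' := by
  subst hz hw
  rfl

theorem mkSU2_mul (z w z' w' : ℂ) (h h') :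
    ∃ h'', mkSU2 z w h * mkSU2 z' w' h' =
      mkSU2 (z * z' - w * (starRingEnd ℂ) w') (z * w' + w * (starRingEnd ℂ) z') h'' := by
  have e : (mkSU2 z w h * mkSU2 z' w' h' : SU2).1 =
      !![z * z' - w * (starRingEnd ℂ) w', z * w' + w * (starRingEnd ℂ) z';
        -(starRingEnd ℂ) (z * w' + w * (starRingEnd ℂ) z'),
        (starRingEnd ℂ) (z * z' - w * (starRingEnd ℂ) w')] := by
    change !![z, w; -(starRingEnd ℂ) w, (starRingEnd ℂ) z] *
      !![z', w'; -(starRingEnd ℂ) w', (starRingEnd ℂ) z'] = _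
    rw [Matrix.mul_fin_two]
    ext i j
    fin_cases i <;> fin_cases j <;> simp <;> ring
  obtain ⟨a, b, hab, e'⟩ := exists_eq_mkSU2 (mkSU2 z w h * mkSU2 z' w' h')
  rw [e'] at e
  have ea := congrFun (congrFun e 0) 0
  have eb := congrFun (congrFun e 0) 1
  simp only [mkSU2, Matrix.of_apply, Matrix.cons_val', Matrix.cons_val_zero,
    Matrix.cons_val_one, Matrix.cons_val_fin_one] at ea eb
  refine ⟨by rw [← ea, ← eb, hab], ?_⟩
  rw [e']
  exact mkSU2_congr ea eb

theorem star_mkSU2 (z w : ℂ) (h) :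
    ∃ h', star (mkSU2 z w h) = mkSU2 ((starRingEnd ℂ) z) (-w) h' := by
  refine ⟨by rw [Complex.normSq_conj, Complex.normSq_neg, h], Subtype.ext ?_⟩
  rw [Matrix.specialUnitaryGroup.coe_star]
  ext i j
  fin_cases i <;> fin_cases j <;> simp [mkSU2, Matrix.star_apply]

theorem dist_mkSU2_le (z w z' w' : ℂ) (h h') :
    dist (mkSU2 z w h) (mkSU2 z' w' h') ≤ ‖z - z'‖ + ‖w - w'‖ := by
  have hJ : ‖(!![0, 1; 1, 0] : Matrix (Fin 2) (Fin 2) ℂ)‖ ≤ 1 := by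
    refine (CStarRing.norm_of_mem_unitary (Matrix.mem_unitaryGroup_iff.2 ?_)).le
    ext i j
    fin_cases i <;> fin_cases j <;> simp [Matrix.mul_apply, Fin.sum_univ_two, Matrix.star_apply]
  have hd : ∀ u v : ℂ, ‖v‖ = ‖u‖ → ‖Matrix.diagonal ![u, v]‖ ≤ ‖u‖ := fun u v huv => by
    rw [Matrix.l2_opNorm_diagonal, pi_norm_le_iff_of_nonneg (norm_nonneg _)]
    intro i
    fin_cases i <;> simp [huv]
  have e : (mkSU2 z w h).1 - (mkSU2 z' w' h').1 =
      Matrix.diagonal ![z - z', (starRingEnd ℂ) (z - z')] +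
      Matrix.diagonal ![w - w', -(starRingEnd ℂ) (w - w')] * !![0, 1; 1, 0] := by
    ext i j
    fin_cases i <;> fin_cases j <;> simp [mkSU2, Matrix.mul_apply, Fin.sum_univ_two]
    ring
  rw [dist_eq, e]
  refine (norm_add_le _ _).trans (add_le_add (hd _ _ (RCLike.norm_conj _)) ?_)
  refine (norm_mul_le _ _).trans ?_
  have := hd (w - w') (-(starRingEnd ℂ) (w - w')) (by rw [norm_neg, RCLike.norm_conj])
  nlinarith [norm_nonneg (Matrix.diagonal ![w - w', -(starRingEnd ℂ) (w - w')]),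
    norm_nonneg (!![0, 1; 1, 0] : Matrix (Fin 2) (Fin 2) ℂ)]

instance : plusMinusOne.Normal := ⟨by
  rintro S hS T
  have hcomm : T * S = S * T := Subtype.ext (by
    rcases hS with hS | hS <;> simp [hS])
  rwa [hcomm, mul_inv_cancel_right]⟩

instance : IsClosed (plusMinusOne : Set SU2) :=
  (isClosed_eq continuous_subtype_val continuous_const).union
    (isClosed_eq continuous_subtype_val continuous_const)

end SU2

/-! ### Diagonal matrices and rotations -/

theorem e2pi_eq (t : ℝ) : e2pi t = Complex.exp ((2 * Real.pi * t : ℝ) * Complex.I) := by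
  simp [e2pi]

theorem e2pi_zero : e2pi 0 = 1 := by simp [e2pi]

theorem e2pi_add (s t : ℝ) : e2pi (s + t) = e2pi s * e2pi t := by
  rw [e2pi, e2pi, e2pi, ← Complex.exp_add]
  congr 1
  push_cast
  ring

theorem e2pi_intCast (n : ℤ) : e2pi n = 1 := by
  rw [e2pi, Complex.exp_eq_one_iff]
  exact ⟨n, by push_cast; ring⟩

theorem norm_e2pi (t : ℝ) : ‖e2pi t‖ = 1 := by
  rw [e2pi_eq, Complex.norm_exp_ofReal_mul_I]

theorem conj_e2pi (t : ℝ) : (starRingEnd ℂ) (e2pi t) = e2pi (-t) := by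
  rw [e2pi, e2pi, ← Complex.exp_conj]
  congr 1
  simp [Complex.conj_ofReal, Complex.conj_ofNat]

theorem norm_e2pi_sub_e2pi_le (s t : ℝ) : ‖e2pi s - e2pi t‖ ≤ 2 * Real.pi * |s - t| := by
  have h : e2pi s - e2pi t = e2pi t * (e2pi (s - t) - 1) := by
    rw [mul_sub, ← e2pi_add, mul_one, add_sub_cancel]
  rw [h, norm_mul, norm_e2pi, one_mul, e2pi_eq, mul_comm (Complex.ofReal _)]
  refine (Real.norm_exp_I_mul_ofReal_sub_one_le).trans ?_
  rw [Real.norm_eq_abs, abs_mul, abs_of_pos (by positivity : 0 < 2 * Real.pi)]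

theorem exists_e2pi_mul_eq {z z' : ℂ} (h : ‖z‖ = ‖z'‖) : ∃ t, e2pi t * z = z' := by
  rcases eq_or_ne z 0 with rfl | hz
  · rw [norm_zero] at h
    exact ⟨0, by rw [mul_zero, eq_comm, ← norm_eq_zero, ← h]⟩
  · refine ⟨Complex.arg (z' / z) / (2 * Real.pi), ?_⟩
    have h1 : ‖z' / z‖ = 1 := by rw [norm_div, h, div_self (h ▸ norm_ne_zero_iff.2 hz)]
    have h2 := Complex.norm_mul_exp_arg_mul_I (z' / z)
    rw [h1, Complex.ofReal_one, one_mul] at h2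
    rw [e2pi_eq, mul_div_cancel₀ _ (by positivity), h2, div_mul_cancel₀ _ hz]

theorem diagSU2_add (s t : ℝ) : diagSU2 (s + t) = diagSU2 s * diagSU2 t := by
  obtain ⟨h, e⟩ := SU2.mkSU2_mul (e2pi s) 0 (e2pi t) 0 (by simp [normSq_e2pi])
    (by simp [normSq_e2pi])
  rw [diagSU2, diagSU2, diagSU2, e]
  exact SU2.mkSU2_congr (by simp [e2pi_add]) (by simp)

theorem diagSU2_zero : diagSU2 0 = 1 := by
  have h := diagSU2_add 0 0
  rw [add_zero] at h
  exact (mul_eq_left (a := diagSU2 0)).1 h.symm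

theorem diagSU2_neg (t : ℝ) : diagSU2 (-t) = (diagSU2 t)⁻¹ :=
  eq_inv_of_mul_eq_one_left (by rw [← diagSU2_add, neg_add_cancel, diagSU2_zero])

theorem diagSU2_add_intCast (t : ℝ) (n : ℤ) : diagSU2 (t + n) = diagSU2 t :=
  SU2.mkSU2_congr (by rw [e2pi_add, e2pi_intCast, mul_one]) rfl

theorem dist_diagSU2_le (s t : ℝ) : dist (diagSU2 s) (diagSU2 t) ≤ 2 * Real.pi * |s - t| := by
  refine (SU2.dist_mkSU2_le _ _ _ _ _ _).trans ?_
  rw [sub_zero, norm_zero, add_zero]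
  exact norm_e2pi_sub_e2pi_le s t

theorem diagSU2_mul_mkSU2_mul (s t : ℝ) (z w : ℂ) (h) :
    ∃ h', diagSU2 s * mkSU2 z w h * diagSU2 t =
      mkSU2 (e2pi (s + t) * z) (e2pi (s - t) * w) h' := by
  obtain ⟨h1, e1⟩ := SU2.mkSU2_mul (e2pi s) 0 z w (by simp [normSq_e2pi]) h
  obtain ⟨h2, e2⟩ := SU2.mkSU2_mul _ _ (e2pi t) 0 h1 (by simp [normSq_e2pi])
  refine ⟨by rw [Complex.normSq_mul, Complex.normSq_mul, normSq_e2pi, normSq_e2pi, one_mul,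
    one_mul, h], ?_⟩
  rw [diagSU2, diagSU2, e1, e2]
  refine SU2.mkSU2_congr ?_ ?_
  · rw [e2pi_add, map_zero]; ring
  · rw [sub_eq_add_neg s, e2pi_add, conj_e2pi]; ring

theorem normSq_cos_add_normSq_sin (θ φ : ℝ) :
    Complex.normSq (Real.cos (θ / 2) : ℝ) +
      Complex.normSq (e2pi φ * (Real.sin (θ / 2) : ℝ)) = 1 := by
  rw [Complex.normSq_mul, normSq_e2pi, Complex.normSq_ofReal, Complex.normSq_ofReal, one_mul]
  nlinarith [Real.sin_sq_add_cos_sq (θ / 2)]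

theorem angleMatrix_mul (θ θ' : ℝ) :
    angleMatrix θ 0 * angleMatrix θ' 0 = angleMatrix (θ + θ') 0 := by
  obtain ⟨h, e⟩ := SU2.mkSU2_mul _ _ _ _ (normSq_cos_add_normSq_sin θ 0)
    (normSq_cos_add_normSq_sin θ' 0)
  rw [angleMatrix, angleMatrix, angleMatrix, e]
  refine SU2.mkSU2_congr ?_ ?_
  · rw [add_div, Real.cos_add, e2pi_zero, one_mul, one_mul, Complex.conj_ofReal]
    push_cast
    ring
  · rw [add_div, Real.sin_add, e2pi_zero, one_mul, one_mul, Complex.conj_ofReal]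
    push_cast
    ring

theorem angleMatrix_zero (φ : ℝ) : angleMatrix 0 φ = 1 := by
  rw [← diagSU2_zero]
  exact SU2.mkSU2_congr (by simp [e2pi_zero]) (by simp)

theorem angleMatrix_neg (θ φ : ℝ) : angleMatrix (-θ) φ = angleMatrix θ (φ + 1 / 2) := by
  refine SU2.mkSU2_congr (by rw [neg_div, Real.cos_neg]) ?_
  have : e2pi (1 / 2) = -1 := by
    rw [e2pi, ← Complex.exp_pi_mul_I]
    congr 1
    push_cast
    ring
  rw [e2pi_add, this, neg_div, Real.sin_neg]
  push_cast
  ring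

theorem angleMatrix_add_intCast (θ φ : ℝ) (n : ℤ) :
    angleMatrix θ (φ + n) = angleMatrix θ φ :=
  SU2.mkSU2_congr rfl (by rw [e2pi_add, e2pi_intCast, mul_one])

theorem dist_angleMatrix_angle_le (θ θ' φ : ℝ) :
    dist (angleMatrix θ φ) (angleMatrix θ' φ) ≤ |θ - θ'| := by
  refine (SU2.dist_mkSU2_le _ _ _ _ _ _).trans ?_
  rw [← mul_sub, norm_mul, norm_e2pi, one_mul, ← Complex.ofReal_sub, ← Complex.ofReal_sub,
    Complex.norm_real, Complex.norm_real, Real.norm_eq_abs, Real.norm_eq_abs]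
  have h1 := Real.abs_cos_sub_cos_le (θ / 2) (θ' / 2)
  have h2 := Real.abs_sin_sub_sin_le (θ / 2) (θ' / 2)
  rw [← sub_div, abs_div, abs_two] at h1 h2
  linarith

theorem dist_angleMatrix_phase_le (θ φ φ' : ℝ) :
    dist (angleMatrix θ φ) (angleMatrix θ φ') ≤ Real.pi * |θ| * |φ - φ'| := by
  refine (SU2.dist_mkSU2_le _ _ _ _ _ _).trans ?_
  rw [sub_self, norm_zero, zero_add, ← sub_mul, norm_mul, Complex.norm_real, Real.norm_eq_abs]
  have h1 := norm_e2pi_sub_e2pi_le φ φ'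
  have h2 : |Real.sin (θ / 2)| ≤ |θ| / 2 := by
    have := Real.abs_sin_le_abs (x := θ / 2)
    rwa [abs_div, abs_two] at this
  calc _ ≤ (2 * Real.pi * |φ - φ'|) * (|θ| / 2) := by gcongr
    _ = _ := by ring

theorem resConj_eq (k : ℤ) (θ φ x : ℝ) : resConj k θ φ x = angleMatrix θ (2 * k * x + φ) := by
  obtain ⟨h, e⟩ := diagSU2_mul_mkSU2_mul (k * x) (-(k * x)) (Real.cos (θ / 2) : ℝ)
    (e2pi φ * (Real.sin (θ / 2) : ℝ)) (normSq_cos_add_normSq_sin θ φ)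
  rw [resConj, Matrix.star_eq_inv, ← diagSU2_neg, angleMatrix, e]
  refine SU2.mkSU2_congr ?_ ?_
  · rw [add_neg_cancel, e2pi_zero, one_mul]
  · rw [e2pi_add, ← mul_assoc]; ring_nf

/-! ### Subgroups of `SU(2)` containing two maximal tori -/

/-- Since the diagonal torus acts on `{z, w}` from both sides by independent changes of the
arguments of `z` and `w`, a subgroup that contains it is determined by the moduli `|z|`. -/
theorem mem_of_norm_entry_eq {Γ : Subgroup SU2} (hΓ : ∀ t, diagSU2 t ∈ Γ)
    {z w z' w' : ℂ} {h h'} (hz : ‖z‖ = ‖z'‖) (hg : mkSU2 z w h ∈ Γ) : mkSU2 z' w' h' ∈ Γ := by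
  have hw : ‖w‖ = ‖w'‖ := by
    have e1 := h
    have e2 := h'
    rw [Complex.normSq_eq_norm_sq, Complex.normSq_eq_norm_sq] at e1 e2
    rw [← sq_eq_sq₀ (norm_nonneg _) (norm_nonneg _)]
    rw [hz] at e1
    linarith
  obtain ⟨p, hp⟩ := exists_e2pi_mul_eq hz
  obtain ⟨q, hq⟩ := exists_e2pi_mul_eq hw
  obtain ⟨h1, e⟩ := diagSU2_mul_mkSU2_mul ((p + q) / 2) ((p - q) / 2) z w h
  have : mkSU2 z' w' h' = diagSU2 ((p + q) / 2) * mkSU2 z w h * diagSU2 ((p - q) / 2) := by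
    rw [e]
    refine SU2.mkSU2_congr ?_ ?_
    · rw [← hp]; ring_nf
    · rw [← hq]; ring_nf
  rw [this]
  exact Γ.mul_mem (Γ.mul_mem (hΓ _) hg) (hΓ _)

/-- The diagonal torus and its conjugate by a rotation of angle `Θ`, which moves the axis of the
torus by an angle between `π / 4` and `3 π / 4`, generate `SU(2)`: the conjugate torus provides
all rotations of small angle up to the torus, and their squares provide the others. -/
theorem subgroup_eq_top_of_two_tori {Γ : Subgroup SU2} (hΓ : ∀ t, diagSU2 t ∈ Γ) {Θ : ℝ}
    (hΘ : 1 / 2 ≤ Real.sin Θ ^ 2)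
    (hΓ' : ∀ t, (angleMatrix Θ 0)⁻¹ * diagSU2 t * angleMatrix Θ 0 ∈ Γ) : Γ = ⊤ := by
  have hsmall : ∀ ψ, 0 ≤ Real.cos ψ → Real.sin ψ ^ 2 ≤ 1 / 2 → angleMatrix (2 * ψ) 0 ∈ Γ := by
    intro ψ hc hψ
    have hpos : 0 < Real.sin Θ ^ 2 := by linarith
    obtain ⟨t, ht⟩ : ∃ t, Real.sin (2 * Real.pi * t) ^ 2 = Real.sin ψ ^ 2 / Real.sin Θ ^ 2 := by
      have h0 : 0 ≤ Real.sin ψ ^ 2 / Real.sin Θ ^ 2 := by positivity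
      have h1 : Real.sin ψ ^ 2 / Real.sin Θ ^ 2 ≤ 1 := (div_le_one hpos).2 (hψ.trans hΘ)
      refine ⟨Real.arcsin √(Real.sin ψ ^ 2 / Real.sin Θ ^ 2) / (2 * Real.pi), ?_⟩
      rw [mul_div_cancel₀ _ (by positivity), Real.sin_arcsin
        (by linarith [Real.sqrt_nonneg (Real.sin ψ ^ 2 / Real.sin Θ ^ 2)])
        (Real.sqrt_le_one.2 h1), Real.sq_sqrt h0]
    have hmem := hΓ' t
    obtain ⟨h1, e1⟩ := SU2.star_mkSU2 _ _ (normSq_cos_add_normSq_sin Θ 0)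
    obtain ⟨h2, e2⟩ := SU2.mkSU2_mul _ _ (e2pi t) 0 h1 (by simp [normSq_e2pi])
    obtain ⟨h3, e3⟩ := SU2.mkSU2_mul _ _ _ _ h2 (normSq_cos_add_normSq_sin Θ 0)
    rw [← Matrix.star_eq_inv, angleMatrix, diagSU2, e1, e2, e3] at hmem
    refine mem_of_norm_entry_eq hΓ ?_ hmem
    rw [← sq_eq_sq₀ (norm_nonneg _) (norm_nonneg _), ← Complex.normSq_eq_norm_sq,
      ← Complex.normSq_eq_norm_sq, Complex.normSq_ofReal, mul_div_cancel_left₀ _ two_ne_zero]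
    have e : ((starRingEnd ℂ) (Real.cos (Θ / 2) : ℝ) * e2pi t -
        -(e2pi 0 * (Real.sin (Θ / 2) : ℝ)) * (starRingEnd ℂ) 0) * (Real.cos (Θ / 2) : ℝ) -
        ((starRingEnd ℂ) (Real.cos (Θ / 2) : ℝ) * 0 +
        -(e2pi 0 * (Real.sin (Θ / 2) : ℝ)) * (starRingEnd ℂ) (e2pi t)) *
        (starRingEnd ℂ) (e2pi 0 * (Real.sin (Θ / 2) : ℝ)) =
        (Real.cos (2 * Real.pi * t) : ℝ) +
          (Real.cos Θ * Real.sin (2 * Real.pi * t) : ℝ) * Complex.I := by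
      rw [conj_e2pi, e2pi_zero, e2pi_eq, e2pi_eq, Complex.exp_mul_I, Complex.exp_mul_I, mul_neg,
        Complex.ofReal_neg, Complex.cos_neg, Complex.sin_neg, ← Complex.ofReal_cos,
        ← Complex.ofReal_sin, show Θ = 2 * (Θ / 2) by ring, Real.cos_two_mul,
        mul_div_cancel_left₀ _ two_ne_zero, one_mul, Complex.conj_ofReal, Complex.conj_ofReal,
        map_zero]
      have hsc : ((Real.sin (Θ / 2) : ℝ) : ℂ) ^ 2 = 1 - ((Real.cos (Θ / 2) : ℝ) : ℂ) ^ 2 := by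
        exact_mod_cast congrArg Complex.ofReal (Real.sin_sq (Θ / 2))
      push_cast at hsc ⊢
      linear_combination (Complex.cos (2 * Real.pi * t) - Complex.sin (2 * Real.pi * t) *
        Complex.I) * hsc
    rw [e, Complex.normSq_add_mul_I, mul_pow, Real.cos_sq', Real.cos_sq' Θ]
    have := div_mul_cancel₀ (Real.sin ψ ^ 2) hpos.ne'
    rw [← ht] at this
    nlinarith [Real.sin_sq_add_cos_sq ψ]
  refine (Subgroup.eq_top_iff' Γ).2 fun g => ?_
  obtain ⟨z, w, h, rfl⟩ := SU2.exists_eq_mkSU2 g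
  have hz : ‖z‖ ≤ 1 := by
    rw [Complex.normSq_eq_norm_sq, Complex.normSq_eq_norm_sq] at h
    nlinarith [norm_nonneg z, sq_nonneg ‖w‖]
  have hcos : Real.cos (Real.arccos ‖z‖) = ‖z‖ :=
    Real.cos_arccos (by linarith [norm_nonneg z]) hz
  have hmem : angleMatrix (2 * (Real.arccos ‖z‖ / 2)) 0 ∈ Γ := by
    refine hsmall _ (Real.cos_nonneg_of_mem_Icc ⟨?_, ?_⟩) ?_
    · linarith [Real.arccos_nonneg ‖z‖, Real.pi_pos]
    · linarith [Real.arccos_le_pi ‖z‖]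
    · have := Real.cos_sq (Real.arccos ‖z‖ / 2)
      rw [mul_div_cancel₀ _ two_ne_zero, hcos] at this
      nlinarith [Real.sin_sq_add_cos_sq (Real.arccos ‖z‖ / 2), norm_nonneg z]
  have hmem2 := Γ.mul_mem hmem hmem
  rw [angleMatrix_mul] at hmem2
  refine mem_of_norm_entry_eq hΓ ?_ hmem2
  rw [Complex.norm_real, Real.norm_eq_abs]
  have e : (2 * (Real.arccos ‖z‖ / 2) + 2 * (Real.arccos ‖z‖ / 2)) / 2 = Real.arccos ‖z‖ := by
    ring
  rw [e, hcos, abs_norm]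

/-! ### Minimal sets of compact group extensions -/

/-- A continuous map of a compact space has a minimal nonempty closed forward-invariant set. -/
theorem exists_minimal_isClosed_mapsTo {X : Type*} [TopologicalSpace X] [CompactSpace X]
    [Nonempty X] (T : X → X) :
    ∃ Y, Minimal (fun Z : Set X => Z.Nonempty ∧ IsClosed Z ∧ Set.MapsTo T Z Z) Y := by
  have hchain : ∀ c ⊆ {Z : Set X | Z.Nonempty ∧ IsClosed Z ∧ Set.MapsTo T Z Z},
      IsChain (· ⊆ ·) c → c.Nonempty →
      ∃ lb ∈ {Z : Set X | Z.Nonempty ∧ IsClosed Z ∧ Set.MapsTo T Z Z}, ∀ Z ∈ c, lb ⊆ Z := by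
    intro c hc hchain hne
    refine ⟨⋂₀ c, ⟨?_, isClosed_sInter fun Z hZ => (hc hZ).2.1, ?_⟩,
      fun Z hZ => Set.sInter_subset_of_mem hZ⟩
    · have := hne.to_subtype
      exact IsCompact.nonempty_sInter_of_directed_nonempty_isCompact_isClosed
        (fun Z hZ W hW => (hchain.total hZ hW).elim (fun h => ⟨Z, hZ, subset_rfl, h⟩)
          fun h => ⟨W, hW, h, subset_rfl⟩) (fun Z hZ => (hc hZ).1)
        (fun Z hZ => (hc hZ).2.1.isCompact) (fun Z hZ => (hc hZ).2.1)
    · intro x hx Z hZ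
      exact (hc hZ).2.2 (hx Z hZ)
  obtain ⟨Y, -, hY⟩ := zorn_superset_nonempty _ hchain Set.univ
    ⟨Set.univ_nonempty, isClosed_univ, Set.mapsTo_univ _ _⟩
  exact ⟨Y, hY⟩

section GroupExtension

variable {B G : Type*} [Group G]

/-- The subgroup of the right translations of the fibers that preserve a subset of `B × G`. -/
def rightStabilizer (Y : Set (B × G)) : Subgroup G where
  carrier := {g | ∀ p : B × G, p ∈ Y ↔ (p.1, p.2 * g) ∈ Y}
  mul_mem' := by
    intro g h hg hh p
    rw [hg, hh, mul_assoc]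
  one_mem' := by simp
  inv_mem' := by
    intro g hg p
    rw [hg (p.1, p.2 * g⁻¹)]
    simp

theorem mem_rightStabilizer {Y : Set (B × G)} {g : G} :
    g ∈ rightStabilizer Y ↔ ∀ p : B × G, p ∈ Y ↔ (p.1, p.2 * g) ∈ Y := Iff.rfl

/-- The fibers of a minimal set of a group extension are cosets of the stabilizer: a translate of
a minimal set is minimal, hence equal to it or disjoint from it. -/
theorem inv_mul_mem_rightStabilizer [TopologicalSpace B] [TopologicalSpace G] [ContinuousMul G]
    {T : B × G → B × G}
    (hT : ∀ p g, T (p.1, p.2 * g) = ((T p).1, (T p).2 * g)) {Y : Set (B × G)}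
    (hY : Minimal (fun Z : Set (B × G) => Z.Nonempty ∧ IsClosed Z ∧ Set.MapsTo T Z Z) Y)
    {x : B} {S S' : G} (hS : (x, S) ∈ Y) (hS' : (x, S') ∈ Y) :
    S⁻¹ * S' ∈ rightStabilizer Y := by
  have key : ∀ (R R' : G), (x, R) ∈ Y → (x, R') ∈ Y →
      ∀ p ∈ Y, (p.1, p.2 * (R⁻¹ * R')) ∈ Y := by
    intro R R' hR hR' p hp
    refine (hY.2 (y := Y ∩ {p | (p.1, p.2 * (R⁻¹ * R')) ∈ Y}) ⟨⟨(x, R), hR, ?_⟩, ?_, ?_⟩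
      Set.inter_subset_left hp).2
    · simpa using hR'
    · exact hY.1.2.1.inter (hY.1.2.1.preimage (by fun_prop))
    · rintro q ⟨hq, hq'⟩
      refine ⟨hY.1.2.2 hq, ?_⟩
      have := hY.1.2.2 hq'
      rwa [hT] at this
  refine mem_rightStabilizer.2 fun p => ⟨key S S' hS hS' p, fun hp => ?_⟩
  have := key S' S hS' hS _ hp
  simpa [mul_assoc] using this

end GroupExtension

/-! ### Rotations by Diophantine angles -/

/-- The forward orbit of `0` under a Diophantine rotation becomes `1 / Q`-dense within a time
which is polynomial in `Q`. -/
theorem IsDiophantine.exists_nat_near {α : ℝ} (hα : IsDiophantine α) :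
    ∃ (C : ℝ) (N : ℕ), ∀ (y : ℝ) (Q : ℕ), 0 < Q →
      ∃ (n : ℕ) (p : ℤ), |n * α - p - y| ≤ 1 / Q ∧ n ≤ C * (Q : ℝ) ^ N := by
  obtain ⟨γ, τ, hγ, h⟩ := hα
  refine ⟨1 / γ, ⌈τ⌉₊ + 1, fun y Q hQ => ?_⟩
  obtain ⟨m, hm, hmQ, hmα⟩ := Real.exists_nat_abs_mul_sub_round_le α hQ
  have hQ1 : (1 : ℝ) ≤ Q := by exact_mod_cast hQ
  have hm1 : (1 : ℝ) ≤ m := by exact_mod_cast hm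
  have hmQ' : (m : ℝ) ≤ Q := by exact_mod_cast hmQ
  set ρ := (m : ℝ) * α - round ((m : ℝ) * α) with hρ
  have hlow : γ / (Q : ℝ) ^ ⌈τ⌉₊ ≤ |ρ| := by
    have h1 := h m (by exact_mod_cast hm.ne')
    rw [Int.cast_natCast, abs_of_pos (by linarith : (0 : ℝ) < m)] at h1
    refine le_trans ?_ h1
    refine div_le_div_of_nonneg_left hγ.le (by positivity) ?_
    calc (m : ℝ) ^ τ ≤ (m : ℝ) ^ (⌈τ⌉₊ : ℝ) := Real.rpow_le_rpow_of_exponent_le hm1 (Nat.le_ceil τ)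
      _ = (m : ℝ) ^ ⌈τ⌉₊ := Real.rpow_natCast _ _
      _ ≤ (Q : ℝ) ^ ⌈τ⌉₊ := by gcongr
  have hρ0 : 0 < |ρ| := lt_of_lt_of_le (by positivity) hlow
  have hρQ : |ρ| ≤ 1 / Q := hmα.trans (by gcongr; linarith)
  -- a representative of `y` modulo `1` with the sign of `ρ`
  obtain ⟨j, hj0, hj1⟩ : ∃ j : ℤ, 0 ≤ (y + j) / ρ ∧ (y + j) / ρ ≤ 1 / |ρ| := by
    rcases lt_or_gt_of_ne (abs_pos.1 hρ0) with hneg | hpos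
    · refine ⟨-⌈y⌉, div_nonneg_of_nonpos ?_ hneg.le, ?_⟩
      · push_cast; linarith [Int.le_ceil y]
      · rw [abs_of_neg hneg, ← neg_div_neg_eq]
        gcongr
        · linarith
        · push_cast; linarith [Int.ceil_lt_add_one y]
    · refine ⟨-⌊y⌋, div_nonneg ?_ hpos.le, ?_⟩
      · push_cast; linarith [Int.floor_le y]
      · rw [abs_of_pos hpos]
        gcongr
        push_cast; linarith [Int.lt_floor_add_one y]
  refine ⟨⌊(y + j) / ρ⌋₊ * m, ⌊(y + j) / ρ⌋₊ * round ((m : ℝ) * α) + j, ?_, ?_⟩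
  · have e : ((⌊(y + j) / ρ⌋₊ * m : ℕ) : ℝ) * α -
        ((⌊(y + j) / ρ⌋₊ * round ((m : ℝ) * α) + j : ℤ) : ℝ) - y =
        (⌊(y + j) / ρ⌋₊ - (y + j) / ρ) * ρ := by
      rw [sub_mul, div_mul_cancel₀ _ (abs_pos.1 hρ0), hρ]
      push_cast
      ring
    rw [e, abs_mul]
    have h1 : |(⌊(y + j) / ρ⌋₊ : ℝ) - (y + j) / ρ| ≤ 1 := by
      rw [abs_le]
      constructor <;> linarith [Nat.floor_le hj0, Nat.lt_floor_add_one ((y + j) / ρ)]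
    nlinarith
  · have h1 : 1 / |ρ| ≤ 1 / (γ / (Q : ℝ) ^ ⌈τ⌉₊) :=
      one_div_le_one_div_of_le (by positivity) hlow
    have h2 : (⌊(y + j) / ρ⌋₊ : ℝ) ≤ 1 / γ * (Q : ℝ) ^ ⌈τ⌉₊ := by
      refine (Nat.floor_le hj0).trans (hj1.trans (h1.trans (le_of_eq ?_)))
      rw [one_div_div]; ring
    push_cast
    calc (⌊(y + j) / ρ⌋₊ : ℝ) * m ≤ (1 / γ * (Q : ℝ) ^ ⌈τ⌉₊) * Q := by gcongr
      _ = _ := by rw [pow_succ, mul_assoc]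

/-! ### Prescribing phases along a lacunary sequence of frequencies -/

/-- Along a lacunary sequence of frequencies, all phases can be prescribed at a single point, up
to the inverse of the lacunarity ratio. -/
theorem exists_phases_near {k : ℕ → ℤ} {c : ℕ → ℝ} {R : ℝ} (hR : 2 ≤ R) {i₀ : ℕ}
    (hk0 : ∀ i, i₀ ≤ i → k i ≠ 0) (hk : ∀ i, i₀ ≤ i → R * |(k i : ℝ)| ≤ |(k (i + 1) : ℝ)|)
    (n : ℕ) : ∀ i, i₀ ≤ i → ∀ y : ℝ, ∃ x : ℝ, |x - y| ≤ 1 / (2 * |(k i : ℝ)|) ∧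
      ∀ j, i ≤ j → j < i + n → ∃ p : ℤ, |2 * k j * x - c j - p| ≤ 1 / R := by
  induction n with
  | zero =>
    intro i hi y
    refine ⟨y, by rw [sub_self, abs_zero]; positivity, fun j h1 h2 => by omega⟩
  | succ n ih =>
    intro i hi y
    have hpos : 0 < |(k i : ℝ)| := abs_pos.2 (by exact_mod_cast hk0 i hi)
    have hne : (k i : ℝ) ≠ 0 := abs_pos.1 hpos
    -- the point nearest to `y` where the first phase is exactly as prescribed
    set p := round (2 * k i * y - c i)
    obtain ⟨x, hx, hxj⟩ := ih (i + 1) (by omega) ((c i + p) / (2 * k i))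
    have hx' : |x - (c i + p) / (2 * k i)| ≤ 1 / (2 * (R * |(k i : ℝ)|)) :=
      hx.trans (by have := hk i hi; gcongr)
    have hy : |(c i + p) / (2 * k i) - y| ≤ 1 / (4 * |(k i : ℝ)|) := by
      have h1 := abs_sub_round (2 * k i * y - c i)
      have e : (c i + p) / (2 * k i) - y = -(2 * k i * y - c i - p) / (2 * k i) := by
        field_simp
        ring
      rw [e, abs_div, abs_neg, abs_mul, abs_two]
      calc _ ≤ (1 / 2) / (2 * |(k i : ℝ)|) := by gcongr
        _ = _ := by ring
    refine ⟨x, ?_, fun j h1 h2 => ?_⟩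
    · have h3 : 1 / (2 * (R * |(k i : ℝ)|)) ≤ 1 / (4 * |(k i : ℝ)|) := by
        apply one_div_le_one_div_of_le (by positivity)
        nlinarith
      calc |x - y| ≤ _ := abs_sub_le _ ((c i + p) / (2 * k i)) _
        _ ≤ 1 / (4 * |(k i : ℝ)|) + 1 / (4 * |(k i : ℝ)|) := add_le_add (hx'.trans h3) hy
        _ = _ := by ring
    · rcases h1.eq_or_lt with rfl | h1
      · refine ⟨p, ?_⟩
        have e : 2 * k i * x - c i - p = 2 * k i * (x - (c i + p) / (2 * k i)) := by
          field_simp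
          ring
        rw [e, abs_mul, abs_mul, abs_two]
        calc _ ≤ 2 * |(k i : ℝ)| * (1 / (2 * (R * |(k i : ℝ)|))) := by gcongr
          _ = _ := by field_simp
      · exact hxj j h1 (by omega)

/-! ### Iterates of a cocycle in KAM normal form -/

/-- The exponential is Lipschitz at `0`. -/
theorem exists_dist_expSU2_one_le :
    ∃ C δ : ℝ, 0 ≤ C ∧ 0 < δ ∧ ∀ X : su2, ‖X‖ < δ → dist (expSU2 X) 1 ≤ C * ‖X‖ := by
  have h := (hasFDerivAt_exp_zero (𝕂 := ℂ)
    (𝔸 := Matrix (Fin 2) (Fin 2) ℂ)).isBigO_sub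
  obtain ⟨C, hC0, hC⟩ := h.exists_nonneg
  obtain ⟨δ, hδ, hball⟩ := Metric.eventually_nhds_iff.1 hC.bound
  refine ⟨C, δ, hC0, hδ, fun X hX => ?_⟩
  have := hball (y := (X : Matrix (Fin 2) (Fin 2) ℂ)) (by rwa [dist_zero_right])
  rw [NormedSpace.exp_zero, sub_zero] at this
  rw [SU2.dist_eq]
  exact this

namespace KAMNormalForm

variable {α : ℝ} (K : KAMNormalForm α)

theorem H_add_mul_map_mul_star_H (i : ℕ) (x : ℝ) :
    K.H i (x + α) * K.map x * star (K.H i x) =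
      diagSU2 (K.a (i + 1)) * expSU2 (K.F (i + 1) x) := by
  induction i with
  | zero => exact K.conj 0 x
  | succ i ih =>
    rw [← K.conj (i + 1) x, ← ih]
    simp only [H, G, star_mul, mul_assoc]

theorem H_add_intCast (i : ℕ) (x : ℝ) (p : ℤ) : K.H i (x + p) = K.H i x := by
  have hG : ∀ j, K.G j (x + p) = K.G j x := fun j => by
    rw [G, G, resConj_eq, resConj_eq]
    have e : 2 * (K.k j : ℝ) * (x + p) + K.φ j =
        2 * K.k j * x + K.φ j + ((2 * K.k j * p : ℤ) : ℝ) := by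
      push_cast
      ring
    rw [e, angleMatrix_add_intCast]
  induction i with
  | zero => exact hG 0
  | succ i ih => rw [H, H, hG, ih]

theorem abs_θ_le (i : ℕ) : |K.θ i| ≤ Real.pi / 2 := abs_le.2 (K.θ_mem i)

theorem dist_H_le (i : ℕ) (x y : ℝ) :
    dist (K.H i x) (K.H i y) ≤
      Real.pi ^ 2 * (∑ j ∈ Finset.range (i + 1), |(K.k j : ℝ)|) * |x - y| := by
  have hG : ∀ j, dist (K.G j x) (K.G j y) ≤ Real.pi ^ 2 * |(K.k j : ℝ)| * |x - y| := fun j => by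
    rw [G, G, resConj_eq, resConj_eq]
    refine (dist_angleMatrix_phase_le _ _ _).trans ?_
    have e : 2 * (K.k j : ℝ) * x + K.φ j - (2 * K.k j * y + K.φ j) = 2 * (K.k j * (x - y)) := by
      ring
    rw [e, abs_mul, abs_mul, abs_two]
    have h := K.abs_θ_le j
    calc _ ≤ Real.pi * (Real.pi / 2) * (2 * (|(K.k j : ℝ)| * |x - y|)) := by gcongr
      _ = _ := by ring
  induction i with
  | zero => simpa [H] using hG 0
  | succ i ih =>
    rw [H, H, Finset.sum_range_succ, mul_add, add_mul]
    rw [add_comm (_ * |x - y|)]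
    exact (SU2.dist_mul_mul_le _ _ _ _).trans (add_le_add (hG _) ih)

/-- The fibered part of the iterates of the cocycle. -/
noncomputable def iter : ℕ → ℝ → SU2
  | 0, _ => 1
  | n + 1, x => K.map (x + n * α) * iter n x

theorem cocycle_coe (x : ℝ) (S : SU2) :
    K.cocycle ((x : UnitAddCircle), S) = (((x + α : ℝ) : UnitAddCircle), K.map x * S) := rfl

theorem cocycle_iterate (n : ℕ) (x : ℝ) (S : SU2) :
    K.cocycle^[n] ((x : UnitAddCircle), S) =
      (((x + n * α : ℝ) : UnitAddCircle), K.iter n x * S) := by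
  induction n with
  | zero => simp [iter]
  | succ n ih =>
    rw [Function.iterate_succ_apply', ih, cocycle_coe, iter, mul_assoc]
    push_cast
    ring_nf

theorem cocycle_mul_right (p : UnitAddCircle × SU2) (g : SU2) :
    K.cocycle (p.1, p.2 * g) = ((K.cocycle p).1, (K.cocycle p).2 * g) := by
  simp only [cocycle, mul_assoc]

/-- Conjugated by `H_i`, the `n`-th iterate is that of the constant `A_{i+1}`, up to an error
which is linear in `n`. -/
theorem dist_H_mul_iter_le {i : ℕ} {e : ℝ} (he : ∀ y, dist (expSU2 (K.F (i + 1) y)) 1 ≤ e)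
    (n : ℕ) (x : ℝ) :
    dist (K.H i (x + n * α) * K.iter n x) (diagSU2 (n * K.a (i + 1)) * K.H i x) ≤ n * e := by
  induction n with
  | zero => simp [iter, diagSU2_zero]
  | succ n ih =>
    have h1 : K.H i (x + (n + 1 : ℕ) * α) * K.iter (n + 1) x =
        (diagSU2 (K.a (i + 1)) * expSU2 (K.F (i + 1) (x + n * α))) *
          (K.H i (x + n * α) * K.iter n x) := by
      rw [← K.H_add_mul_map_mul_star_H, iter, Matrix.star_eq_inv]
      push_cast
      rw [add_mul, one_mul, ← add_assoc]
      group
    have h2 : diagSU2 ((n + 1 : ℕ) * K.a (i + 1)) * K.H i x =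
        (diagSU2 (K.a (i + 1)) * 1) * (diagSU2 (n * K.a (i + 1)) * K.H i x) := by
      rw [mul_one, ← mul_assoc, ← diagSU2_add]
      push_cast
      ring_nf
    rw [h1, h2]
    refine (SU2.dist_mul_mul_le _ _ _ _).trans ?_
    rw [SU2.dist_mul_left]
    push_cast
    linarith [he (x + n * α)]

/-! ### Growth of the resonances -/

theorem one_le_abs_k (i : ℕ) : 1 ≤ |K.k (i + 1)| :=
  lt_of_le_of_lt (pow_nonneg (abs_nonneg _) _) (K.growth i)

theorem two_le_abs_k (i : ℕ) : 2 ≤ |K.k (i + 2)| :=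
  lt_of_le_of_lt (one_le_pow₀ (K.one_le_abs_k i)) (K.growth (i + 1))

theorem eventually_mul_abs_k_le (R : ℝ) :
    ∀ᶠ i in atTop, R * |(K.k i : ℝ)| ≤ |(K.k (i + 1) : ℝ)| := by
  obtain ⟨m, hm⟩ := pow_unbounded_of_one_lt R (one_lt_two (α := ℝ))
  filter_upwards [eventually_ge_atTop 2, K.tendsto_s.eventually_ge_atTop (m + 1)] with i hi hs
  obtain ⟨j, rfl⟩ := Nat.exists_eq_add_of_le' hi
  have h2 : (2 : ℝ) ≤ |(K.k (j + 2) : ℝ)| := by exact_mod_cast K.two_le_abs_k j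
  have h3 : |(K.k (j + 2) : ℝ)| ^ K.s (j + 2) ≤ |(K.k (j + 2 + 1) : ℝ)| := by
    exact_mod_cast (K.growth (j + 2)).le
  refine le_trans ?_ h3
  calc R * |(K.k (j + 2) : ℝ)| ≤ |(K.k (j + 2) : ℝ)| ^ m * |(K.k (j + 2) : ℝ)| := by
        gcongr
        exact hm.le.trans (by gcongr)
    _ = |(K.k (j + 2) : ℝ)| ^ (m + 1) := (pow_succ _ _).symm
    _ ≤ _ := pow_le_pow_right₀ (by linarith) hs

theorem tendsto_abs_k : Tendsto (fun i => |(K.k i : ℝ)|) atTop atTop := by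
  refine (tendsto_add_atTop_iff_nat 1).1 ?_
  refine tendsto_atTop.2 fun R => ?_
  filter_upwards [K.eventually_mul_abs_k_le (max R 0), eventually_ge_atTop 1] with i hi h1
  obtain ⟨j, rfl⟩ := Nat.exists_eq_add_of_le' h1
  have : (1 : ℝ) ≤ |(K.k (j + 1) : ℝ)| := by exact_mod_cast K.one_le_abs_k j
  nlinarith [le_max_left R 0, le_max_right R 0]

theorem tendsto_sum_abs_k_div :
    Tendsto (fun i => (∑ j ∈ Finset.range i, |(K.k j : ℝ)|) / |(K.k i : ℝ)|) atTop (𝓝 0) := by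
  refine Metric.tendsto_nhds.2 fun ε hε => ?_
  set R : ℝ := 2 + 2 / ε
  have hR : 0 < R - 1 := by
    have : 0 < 2 / ε := by positivity
    linarith
  obtain ⟨i₀, hi₀⟩ := eventually_atTop.1 (K.eventually_mul_abs_k_le R)
  set L := ∑ j ∈ Finset.range i₀, |(K.k j : ℝ)|
  have key : ∀ i, i₀ ≤ i → ∑ j ∈ Finset.range i, |(K.k j : ℝ)| ≤ L + |(K.k i : ℝ)| / (R - 1) := by
    intro i hi
    induction i, hi using Nat.le_induction with
    | base => exact le_add_of_nonneg_right (by positivity)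
    | succ i hi ih =>
      have e : |(K.k i : ℝ)| / (R - 1) + |(K.k i : ℝ)| = R * |(K.k i : ℝ)| / (R - 1) := by
        field_simp
        ring
      have := div_le_div_of_nonneg_right (hi₀ i hi) hR.le
      rw [Finset.sum_range_succ]
      linarith
  have hRε : 1 / (R - 1) < ε / 2 := by
    rw [div_lt_iff₀ hR]
    have : ε / 2 * (R - 1) = 1 + ε / 2 := by
      simp only [R]
      field_simp
      ring
    linarith
  filter_upwards [eventually_ge_atTop i₀, K.tendsto_abs_k.eventually_gt_atTop 0,
    K.tendsto_abs_k.eventually_ge_atTop (2 * L / ε)] with i hi hpos hL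
  rw [Real.dist_eq, sub_zero, abs_of_nonneg (by positivity), div_lt_iff₀ hpos]
  refine (key i hi).trans_lt ?_
  rw [div_le_iff₀ hε] at hL
  rw [div_eq_mul_one_div]
  nlinarith

/-! ### Return times that do not see the conjugation -/

theorem norm_F_le (i : ℕ) (x : ℝ) : ‖K.F i x‖ ≤ ⨆ y, ‖K.F i y‖ := by
  have h := (K.periodic i).isBounded_of_continuous one_ne_zero (K.smooth i).continuous
  obtain ⟨C, hC⟩ := h.exists_norm_le
  exact le_ciSup (f := fun y => ‖K.F i y‖) ⟨C, by
    rintro _ ⟨y, rfl⟩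
    exact hC _ ⟨y, rfl⟩⟩ x

theorem small_F : IsBigOInfty K.k (fun i => ⨆ x, ‖K.F i x‖) := by
  simpa only [iteratedDeriv_zero] using K.small 0

/-- A sequence that is `O(|k_i| ^ {-∞})` tends to `0` even after multiplication by times that grow
polynomially in `|k_i|`. -/
theorem tendsto_mul_of_isBigOInfty {u : ℕ → ℝ} (hu : IsBigOInfty K.k u) (hu0 : ∀ i, 0 ≤ u i)
    {n : ℕ → ℕ} {C : ℝ} {m : ℕ} (hn : ∀ i, (n i : ℝ) ≤ C * |(K.k (i + 1) : ℝ)| ^ m) :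
    Tendsto (fun i => n i * u (i + 1)) atTop (𝓝 0) := by
  obtain ⟨C', hC'⟩ := hu (m + 1)
  have hk := (tendsto_add_atTop_iff_nat 1).2 K.tendsto_abs_k
  have hC : 0 ≤ C := by
    by_contra! hneg
    have h1 : (0 : ℝ) < |(K.k (0 + 1) : ℝ)| :=
      lt_of_lt_of_le one_pos (by exact_mod_cast K.one_le_abs_k 0)
    have h2 := (Nat.cast_nonneg (α := ℝ) (n 0)).trans (hn 0)
    nlinarith [pow_pos h1 m]
  refine squeeze_zero (fun i => mul_nonneg (Nat.cast_nonneg _) (hu0 _)) (fun i => ?_)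
    (hk.const_div_atTop (C * C'))
  have h1 : (0 : ℝ) < |(K.k (i + 1) : ℝ)| :=
    lt_of_lt_of_le one_pos (by exact_mod_cast K.one_le_abs_k i)
  rw [le_div_iff₀ h1]
  calc _ ≤ C * |(K.k (i + 1) : ℝ)| ^ m * u (i + 1) * |(K.k (i + 1) : ℝ)| := by
        gcongr
        · exact hu0 _
        · exact hn i
    _ = C * (|(K.k (i + 1) : ℝ)| ^ (m + 1) * u (i + 1)) := by ring
    _ ≤ C * C' := by gcongr; exact hC' _

/-- For every `s` there are times `n_i`, polynomial in `|k_{i+1}|`, with `n_i α` close to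
`s / k_{i+1}` modulo `ℤ`. Such times return so close to the origin that `H_i` does not notice,
while the resonance turns the constant `A_{i+1}` into `{e^{2 i π s}, 0}`. -/
theorem exists_returns (hα : IsDiophantine α) (s : ℝ) :
    ∃ (n : ℕ → ℕ) (p : ℕ → ℤ) (C : ℝ) (m : ℕ),
      (∀ i, |n i * α - p i| ≤ (|s| + 2) / |(K.k (i + 1) : ℝ)|) ∧
      (∀ i, (n i : ℝ) ≤ C * |(K.k (i + 1) : ℝ)| ^ m) ∧
      Tendsto (fun i => diagSU2 (n i * K.a (i + 1))) atTop (𝓝 (diagSU2 s)) := by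
  obtain ⟨C, m, h⟩ := hα.exists_nat_near
  have hk1 : ∀ i, (1 : ℝ) ≤ |(K.k (i + 1) : ℝ)| := fun i => by exact_mod_cast K.one_le_abs_k i
  have hk0 : ∀ i, (K.k (i + 1) : ℝ) ≠ 0 := fun i =>
    abs_pos.1 (lt_of_lt_of_le one_pos (hk1 i))
  have hQ : ∀ i, (((K.k (i + 1)).natAbs ^ 2 : ℕ) : ℝ) = |(K.k (i + 1) : ℝ)| ^ 2 := fun i => by
    rw [Nat.cast_pow, Nat.cast_natAbs, Int.cast_abs]
  choose n p hnp hn using fun i => h (s / (2 * K.k (i + 1))) ((K.k (i + 1)).natAbs ^ 2)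
    (pow_pos (Int.natAbs_pos.2 (by exact_mod_cast hk0 i)) 2)
  simp only [hQ] at hnp hn
  have hn' : ∀ i, ((2 * n i : ℕ) : ℝ) ≤ 2 * C * |(K.k (i + 1) : ℝ)| ^ (2 * m) := fun i => by
    rw [pow_mul]
    push_cast
    linarith [hn i]
  refine ⟨fun i => 2 * n i, fun i => 2 * p i, 2 * C, 2 * m, fun i => ?_, hn', ?_⟩
  · have e : ((2 * n i : ℕ) : ℝ) * α - ((2 * p i : ℤ) : ℝ) =
        2 * (n i * α - p i - s / (2 * K.k (i + 1))) + s / K.k (i + 1) := by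
      have := hk0 i
      push_cast
      field_simp
      ring
    rw [e]
    refine (abs_add_le _ _).trans ?_
    rw [abs_mul, abs_two, abs_div, add_div, add_comm]
    have h1 : 1 / |(K.k (i + 1) : ℝ)| ^ 2 ≤ 1 / |(K.k (i + 1) : ℝ)| :=
      one_div_le_one_div_of_le (by linarith [hk1 i]) (by nlinarith [hk1 i])
    have h2 : 2 / |(K.k (i + 1) : ℝ)| = 2 * (1 / |(K.k (i + 1) : ℝ)|) := by ring
    rw [h2]
    linarith [hnp i]
  · have hres := K.tendsto_mul_of_isBigOInfty K.resonant (fun _ => abs_nonneg _) hn'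
    have hk := (tendsto_add_atTop_iff_nat 1).2 K.tendsto_abs_k
    have hlim := (hres.add (hk.const_div_atTop 2)).const_mul (2 * Real.pi)
    rw [add_zero, mul_zero] at hlim
    refine tendsto_iff_dist_tendsto_zero.2 (squeeze_zero (fun _ => dist_nonneg) (fun i => ?_) hlim)
    -- modulo `ℤ`, the argument differs from `s` only by small terms, because the number of
    -- iterations is even and `a - k α` is close to `ℤ / 2`
    set b := K.a (i + 1) - K.k (i + 1) * α with hb
    set e := n i * α - p i - s / (2 * K.k (i + 1)) with he
    have hs : ((2 * n i : ℕ) : ℝ) * K.a (i + 1) =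
        s + (((2 * n i : ℕ) : ℝ) * modHalf b + K.k (i + 1) * (2 * e)) +
          ((n i * round (2 * b) + K.k (i + 1) * (2 * p i) : ℤ) : ℝ) := by
      have := hk0 i
      rw [modHalf, he]
      push_cast
      have hb' : K.a (i + 1) = b + K.k (i + 1) * α := by rw [hb]; ring
      rw [hb']
      field_simp
      ring
    rw [hs, diagSU2_add_intCast]
    refine (dist_diagSU2_le _ _).trans ?_
    rw [add_sub_cancel_left]
    refine mul_le_mul_of_nonneg_left ((abs_add_le _ _).trans ?_) (by positivity)
    rw [abs_mul, abs_mul, abs_mul, abs_two, Nat.abs_cast]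
    refine add_le_add le_rfl ?_
    calc |(K.k (i + 1) : ℝ)| * (2 * |e|)
        ≤ |(K.k (i + 1) : ℝ)| * (2 * (1 / |(K.k (i + 1) : ℝ)| ^ 2)) := by gcongr; exact hnp i
      _ = 2 / |(K.k (i + 1) : ℝ)| := by
        have := abs_pos.2 (hk0 i)
        field_simp

/-- Along suitable return times of the rotation, the fibered part of the iterates is uniformly
close to `H_i^* {e^{2 i π s}, 0} H_i`. -/
theorem exists_iter_near (hα : IsDiophantine α) (s : ℝ) :
    ∃ n : ℕ → ℕ, Tendsto (fun i => ((n i * α : ℝ) : UnitAddCircle)) atTop (𝓝 0) ∧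
      ∃ e : ℕ → ℝ, Tendsto e atTop (𝓝 0) ∧ ∀ᶠ i in atTop, ∀ x,
        dist (K.iter (n i) x) ((K.H i x)⁻¹ * diagSU2 s * K.H i x) ≤ e i := by
  obtain ⟨n, p, C, m, hp, hn, hdiag⟩ := K.exists_returns hα s
  obtain ⟨c, δ, hc, hδ, hexp⟩ := exists_dist_expSU2_one_le
  have hk := (tendsto_add_atTop_iff_nat 1).2 K.tendsto_abs_k
  have hF0 : ∀ i, 0 ≤ ⨆ x, ‖K.F i x‖ := fun i => (norm_nonneg _).trans (K.norm_F_le i 0)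
  have hnF := K.tendsto_mul_of_isBigOInfty K.small_F hF0 hn
  have hF : Tendsto (fun i => ⨆ x, ‖K.F (i + 1) x‖) atTop (𝓝 0) := by
    have := K.tendsto_mul_of_isBigOInfty K.small_F hF0 (n := fun _ => 1) (C := 1) (m := 0)
      (fun i => by simp)
    simpa using this
  have hsum := (tendsto_add_atTop_iff_nat 1).2 K.tendsto_sum_abs_k_div
  refine ⟨n, ?_, fun i => n i * (⨆ x, ‖K.F (i + 1) x‖) * c +
    (Real.pi ^ 2 * (|s| + 2) * ((∑ j ∈ Finset.range (i + 1), |(K.k j : ℝ)|) /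
      |(K.k (i + 1) : ℝ)|) + dist (diagSU2 (n i * K.a (i + 1))) (diagSU2 s)), ?_, ?_⟩
  · have h0 : Tendsto (fun i => (n i * α - p i : ℝ)) atTop (𝓝 0) :=
      squeeze_zero_norm (fun i => hp i) (hk.const_div_atTop _)
    have h1 := ((AddCircle.continuous_mk' (1 : ℝ)).tendsto 0).comp h0
    refine (h1.congr fun i => ?_)
    rw [Function.comp_apply]
    have e : ((p i : ℝ) : UnitAddCircle) = 0 := by
      rw [AddCircle.coe_eq_zero_iff]
      exact ⟨p i, by simp⟩
    change ((n i * α - p i : ℝ) : UnitAddCircle) = _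
    rw [AddCircle.coe_sub, e, sub_zero]
  · have := (hnF.mul_const c).add ((hsum.const_mul (Real.pi ^ 2 * (|s| + 2))).add
      (tendsto_iff_dist_tendsto_zero.1 hdiag))
    simpa using this
  · filter_upwards [hF.eventually_lt_const hδ] with i hi x
    have h1 := K.dist_H_mul_iter_le (i := i) (e := c * ⨆ x, ‖K.F (i + 1) x‖) (fun y => ?_) (n i) x
    · have h2 : dist (K.H i (x + n i * α)) (K.H i x) ≤ Real.pi ^ 2 * (|s| + 2) *
          ((∑ j ∈ Finset.range (i + 1), |(K.k j : ℝ)|) / |(K.k (i + 1) : ℝ)|) := by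
        have e : x + n i * α = x + (n i * α - p i) + p i := by ring
        rw [e, K.H_add_intCast]
        refine (K.dist_H_le _ _ _).trans ?_
        rw [add_sub_cancel_left]
        calc _ ≤ Real.pi ^ 2 * (∑ j ∈ Finset.range (i + 1), |(K.k j : ℝ)|) *
              ((|s| + 2) / |(K.k (i + 1) : ℝ)|) := by gcongr; exact hp i
          _ = _ := by ring
      rw [← SU2.dist_mul_left (K.H i (x + n i * α))]
      have h3 : dist (diagSU2 (n i * K.a (i + 1)) * K.H i x)
          (K.H i (x + n i * α) * ((K.H i x)⁻¹ * diagSU2 s * K.H i x)) ≤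
          dist (K.H i (x + n i * α)) (K.H i x) +
            dist (diagSU2 (n i * K.a (i + 1))) (diagSU2 s) := by
        have e : diagSU2 (n i * K.a (i + 1)) * K.H i x =
            K.H i x * ((K.H i x)⁻¹ * diagSU2 (n i * K.a (i + 1)) * K.H i x) := by group
        rw [e]
        refine (SU2.dist_mul_mul_le _ _ _ _).trans ?_
        rw [SU2.dist_mul_right, SU2.dist_mul_left, dist_comm (K.H i x)]
      calc _ ≤ _ := dist_triangle _ _ _
        _ ≤ _ := add_le_add h1 (h3.trans (add_le_add h2 le_rfl))
        _ = _ := by ring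
    · refine (hexp _ ((K.norm_F_le _ y).trans_lt hi)).trans ?_
      gcongr
      exact K.norm_F_le _ y

/-! ### Directions of the products of the `D_i` and of the `G_i` -/

/-- If the angles were summable, then the products `D_i ⋯ D_0` would converge. -/
theorem not_summable_abs_θ (h : ∃ P Q : SO3, P ≠ Q ∧
    MapClusterPt P atTop (fun i => (K.prodD i : SO3)) ∧
    MapClusterPt Q atTop (fun i => (K.prodD i : SO3))) : ¬ Summable fun i => |K.θ i| := by
  intro hsum
  obtain ⟨P, Q, hPQ, hP, hQ⟩ := h
  have hc : CauchySeq K.prodD := by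
    refine cauchySeq_of_dist_le_of_summable _ (fun i => ?_)
      ((summable_nat_add_iff 1).2 hsum)
    have h1 : dist (K.prodD i) (K.prodD (i + 1)) =
        dist (1 * K.prodD i) (K.D (i + 1) * K.prodD i) := by rw [one_mul, prodD]
    rw [h1, SU2.dist_mul_right, dist_comm, D, ← angleMatrix_zero (K.φ (i + 1))]
    simpa using dist_angleMatrix_angle_le (K.θ (i + 1)) 0 (K.φ (i + 1))
  obtain ⟨R, hR⟩ := cauchySeq_tendsto_of_complete hc
  have hlim : Tendsto (fun i => (K.prodD i : SO3)) atTop (𝓝 (R : SO3)) :=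
    (continuous_quotient_mk'.tendsto R).comp hR
  have huniq : ∀ P' : SO3, MapClusterPt P' atTop (fun i => (K.prodD i : SO3)) → P' = R :=
    fun P' hP' => by
      have : (𝓝 P' ⊓ 𝓝 (R : SO3)).NeBot := hP'.neBot.mono (inf_le_inf_left _ hlim)
      exact eq_of_nhds_neBot this
  exact hPQ ((huniq P hP).trans (huniq Q hQ).symm)

/-- If the angles are not summable, there are points at which the rotations `G_j`, `i < j ≤ i'`,
are almost aligned, so that their angles add up to a rotation of the axis by an angle between
`π / 4` and `3 π / 4`. -/
theorem exists_dist_H_angleMatrix_mul_H_le (hθ : ¬ Summable fun i => |K.θ i|) {ε : ℝ}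
    (hε : 0 < ε) (i₀ : ℕ) :
    ∃ i i' : ℕ, i₀ ≤ i ∧ i ≤ i' ∧ ∃ x Θ : ℝ, Θ ∈ Set.Icc (Real.pi / 4) (3 * Real.pi / 4) ∧
      dist (K.H i' x) (angleMatrix Θ 0 * K.H i x) ≤ ε := by
  set R := max 2 (Real.pi ^ 2 / ε)
  have hR2 : 2 ≤ R := le_max_left _ _
  have hRε : Real.pi ^ 2 ≤ ε * R := by
    rw [← div_le_iff₀' hε]
    exact le_max_right _ _
  obtain ⟨i₁, hi₁⟩ := eventually_atTop.1 ((eventually_ge_atTop (max i₀ 1)).and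
    (K.eventually_mul_abs_k_le R))
  have hi : max i₀ 1 ≤ i₁ := (hi₁ i₁ le_rfl).1
  set S : ℕ → ℝ := fun n => ∑ j ∈ Finset.range n, |K.θ (i₁ + 1 + j)|
  have hS : ∃ n, Real.pi / 4 ≤ S n := by
    have h1 : ¬ Summable fun j => |K.θ (i₁ + 1 + j)| := fun h => hθ (by
      refine (summable_nat_add_iff (i₁ + 1)).1 (h.congr fun j => ?_)
      rw [add_comm])
    have h2 := (not_summable_iff_tendsto_nat_atTop_of_nonneg fun j => abs_nonneg _).1 h1
    exact (h2.eventually_ge_atTop _).exists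
  classical
  set n := Nat.find hS
  have hSn : Real.pi / 4 ≤ S n := Nat.find_spec hS
  have hn0 : n ≠ 0 := fun h0 => by
    rw [h0] at hSn
    simp only [S, Finset.range_zero, Finset.sum_empty] at hSn
    linarith [Real.pi_pos]
  have hSn' : S n ≤ 3 * Real.pi / 4 := by
    obtain ⟨m, hm⟩ := Nat.exists_eq_succ_of_ne_zero hn0
    have h1 : ¬ Real.pi / 4 ≤ S m := Nat.find_min hS (by omega)
    have h2 : S n = S m + |K.θ (i₁ + 1 + m)| := by
      rw [hm]
      exact Finset.sum_range_succ _ _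
    linarith [K.abs_θ_le (i₁ + 1 + m)]
  obtain ⟨x, -, hx⟩ := exists_phases_near (k := K.k)
    (c := fun j => -K.φ j - if 0 ≤ K.θ j then 0 else 1 / 2) hR2 (i₀ := i₁)
    (fun i hi' => by
      obtain ⟨j, rfl⟩ := Nat.exists_eq_add_of_le' ((le_max_right i₀ 1).trans (hi.trans hi'))
      exact abs_pos.1 (lt_of_lt_of_le one_pos (K.one_le_abs_k j)))
    (fun i hi' => (hi₁ i hi').2) n (i₁ + 1) (by omega) 0
  have hG : ∀ j, i₁ + 1 ≤ j → j < i₁ + 1 + n →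
      dist (K.G j x) (angleMatrix |K.θ j| 0) ≤ Real.pi / R * |K.θ j| := by
    intro j h1 h2
    obtain ⟨p, hp⟩ := hx j h1 h2
    have e : K.G j x = angleMatrix |K.θ j|
        (2 * K.k j * x - (-K.φ j - if 0 ≤ K.θ j then 0 else 1 / 2)) := by
      rw [G, resConj_eq]
      split_ifs with h0
      · rw [abs_of_nonneg h0]
        ring_nf
      · rw [abs_of_neg (not_le.1 h0), angleMatrix_neg]
        have : 2 * K.k j * x - (-K.φ j - 1 / 2) + 1 / 2 =
            2 * K.k j * x + K.φ j + (1 : ℤ) := by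
          push_cast
          ring
        rw [this, angleMatrix_add_intCast]
    have e0 : angleMatrix |K.θ j| 0 = angleMatrix |K.θ j| p := by
      rw [← angleMatrix_add_intCast _ 0 p, zero_add]
    rw [e, e0]
    refine (dist_angleMatrix_phase_le _ _ _).trans ?_
    rw [abs_abs]
    calc _ ≤ Real.pi * |K.θ j| * (1 / R) := by gcongr
      _ = _ := by ring
  have hH : ∀ m, m ≤ n →
      dist (K.H (i₁ + m) x) (angleMatrix (S m) 0 * K.H i₁ x) ≤ Real.pi / R * S m := by
    intro m
    induction m with
    | zero => intro _; simp [S, angleMatrix_zero]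
    | succ m ih =>
      intro hm
      have e1 : K.H (i₁ + (m + 1)) x = K.G (i₁ + 1 + m) x * K.H (i₁ + m) x := by
        rw [← add_assoc, H, add_right_comm]
      have e2 : S (m + 1) = |K.θ (i₁ + 1 + m)| + S m := by
        simp only [S]
        rw [Finset.sum_range_succ, add_comm]
      rw [e1, e2, ← angleMatrix_mul, mul_assoc, mul_add]
      exact (SU2.dist_mul_mul_le _ _ _ _).trans
        (add_le_add (hG _ (by omega) (by omega)) (ih (by omega)))
  refine ⟨i₁, i₁ + n, (le_max_left _ _).trans hi, by omega, x, S n, ⟨hSn, hSn'⟩,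
    (hH n le_rfl).trans ?_⟩
  have hRpos : 0 < R := by linarith
  calc Real.pi / R * S n ≤ Real.pi / R * Real.pi := by
        gcongr
        linarith [Real.pi_pos]
    _ = Real.pi ^ 2 / R := by ring
    _ ≤ ε := (div_le_iff₀ hRpos).2 hRε

/-! ### Minimal sets of the cocycle -/

theorem continuous_map : Continuous K.map := by
  refine continuous_const.mul (Continuous.subtype_mk ?_ _)
  let _ : NormedAlgebra ℚ (Matrix (Fin 2) (Fin 2) ℂ) := NormedAlgebra.restrictScalars ℚ ℂ _
  exact NormedSpace.exp_continuous.comp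
    (continuous_subtype_val.comp (K.smooth 0).continuous)

theorem continuous_cocycle : Continuous K.cocycle := by
  have h : Continuous K.map_periodic.lift :=
    K.continuous_map.quotient_liftOn' _
  exact (continuous_fst.add continuous_const).prodMk
    ((h.comp continuous_fst).mul continuous_snd)

section

variable {Y : Set (UnitAddCircle × SU2)}

theorem iterate_mem (hmaps : Set.MapsTo K.cocycle Y Y) (n : ℕ) {x : ℝ} {S : SU2}
    (h : ((x : UnitAddCircle), S) ∈ Y) :
    (((x + n * α : ℝ) : UnitAddCircle), K.iter n x * S) ∈ Y := by
  rw [← K.cocycle_iterate]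
  exact hmaps.iterate n h

/-- A closed invariant set projects onto the circle, as the rotation by `α` has dense orbits. -/
theorem exists_mem_fiber (hα : IsDiophantine α) (hne : Y.Nonempty) (hcl : IsClosed Y)
    (hmaps : Set.MapsTo K.cocycle Y Y) (x : UnitAddCircle) : ∃ S, (x, S) ∈ Y := by
  obtain ⟨⟨y, S₀⟩, hy⟩ := hne
  obtain ⟨y, rfl⟩ := QuotientAddGroup.mk_surjective y
  obtain ⟨x, rfl⟩ := QuotientAddGroup.mk_surjective x
  obtain ⟨C, N, h⟩ := hα.exists_nat_near
  choose n p hnp using fun m : ℕ => h (x - y) (m + 1) m.succ_pos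
  have hlim : Tendsto (fun m => y + n m * α - p m) atTop (𝓝 x) := by
    refine tendsto_iff_dist_tendsto_zero.2 (squeeze_zero (fun _ => dist_nonneg) (fun m => ?_)
      (tendsto_one_div_add_atTop_nhds_zero_nat (𝕜 := ℝ)))
    have := (hnp m).1
    rw [Real.dist_eq]
    push_cast at this
    refine le_trans (le_of_eq ?_) this
    ring_nf
  have hmem : ((x : UnitAddCircle)) ∈ Prod.fst '' Y := by
    refine (hcl.isCompact.image continuous_fst).isClosed.mem_of_tendsto
      (((AddCircle.continuous_mk' (1 : ℝ)).tendsto x).comp hlim) (Eventually.of_forall fun m => ?_)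
    refine ⟨_, K.iterate_mem hmaps (n m) hy, ?_⟩
    have e : ((p m : ℝ) : UnitAddCircle) = 0 := by
      rw [AddCircle.coe_eq_zero_iff]
      exact ⟨p m, by simp⟩
    change _ = ((y + n m * α - p m : ℝ) : UnitAddCircle)
    rw [AddCircle.coe_sub, e, sub_zero]
  obtain ⟨⟨_, S⟩, hS, rfl⟩ := hmem
  exact ⟨S, hS⟩

/-- The fibers of a closed invariant set are invariant under the maximal tori whose axes are
limits of the axes of `H_i^*`. -/
theorem conj_diagSU2_mul_mem (hα : IsDiophantine α) (hcl : IsClosed Y)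
    (hmaps : Set.MapsTo K.cocycle Y Y) {x : ℕ → ℝ} {S : ℕ → SU2} {i : ℕ → ℕ}
    (hY : ∀ m, ((x m : UnitAddCircle), S m) ∈ Y) (hi : Tendsto i atTop atTop)
    {x' : UnitAddCircle} {S' h : SU2} (hx : Tendsto (fun m => (x m : UnitAddCircle)) atTop (𝓝 x'))
    (hS : Tendsto S atTop (𝓝 S')) (hH : Tendsto (fun m => K.H (i m) (x m)) atTop (𝓝 h)) (s : ℝ) :
    (x', h⁻¹ * diagSU2 s * h * S') ∈ Y := by
  obtain ⟨n, hn, e, he, hiter⟩ := K.exists_iter_near hα s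
  have h1 : Tendsto (fun m => ((x m + n (i m) * α : ℝ) : UnitAddCircle)) atTop (𝓝 x') := by
    have := hx.add (hn.comp hi)
    rw [add_zero] at this
    exact this
  have h2 : Tendsto (fun m => K.iter (n (i m)) (x m)) atTop (𝓝 (h⁻¹ * diagSU2 s * h)) := by
    refine tendsto_of_tendsto_of_dist ((hH.inv.mul tendsto_const_nhds).mul hH) ?_
    refine squeeze_zero' (Eventually.of_forall fun _ => dist_nonneg) ?_ (he.comp hi)
    filter_upwards [hi.eventually hiter] with m hm
    rw [dist_comm]
    exact hm (x m)
  exact hcl.mem_of_tendsto (h1.prodMk_nhds (h2.mul hS))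
    (Eventually.of_forall fun m => K.iterate_mem hmaps _ (hY m))

/-- The stabilizer of a minimal set contains the limits of the tori given by `H_i(x)` and
`H_{i'}(x)` at points where `G_{i+1}, …, G_{i'}` are almost aligned, and these limits are different. -/
theorem rightStabilizer_eq_top (hα : IsDiophantine α) (hθ : ¬ Summable fun i => |K.θ i|)
    (hY : Minimal (fun Z : Set (UnitAddCircle × SU2) =>
      Z.Nonempty ∧ IsClosed Z ∧ Set.MapsTo K.cocycle Z Z) Y) : rightStabilizer Y = ⊤ := by
  obtain ⟨hne, hcl, hmaps⟩ := hY.1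
  choose i i' hi hii' x Θ hΘ hd using fun m : ℕ =>
    K.exists_dist_H_angleMatrix_mul_H_le hθ (Nat.one_div_pos_of_nat (α := ℝ) (n := m)) m
  choose S hS using fun m => K.exists_mem_fiber hα hne hcl hmaps (x m : UnitAddCircle)
  have : CompactSpace (Set.Icc (Real.pi / 4) (3 * Real.pi / 4)) :=
    isCompact_iff_compactSpace.1 isCompact_Icc
  obtain ⟨⟨x', S', h, Θ'⟩, ν, hν, hlim⟩ := CompactSpace.tendsto_subseq
    (fun m => (((x m : UnitAddCircle), S m, K.H (i m) (x m), ⟨Θ m, hΘ m⟩) :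
      UnitAddCircle × SU2 × SU2 × Set.Icc (Real.pi / 4) (3 * Real.pi / 4)))
  have hx' : Tendsto (fun m => (x (ν m) : UnitAddCircle)) atTop (𝓝 x') :=
    (continuous_fst.tendsto _).comp hlim
  have hS' : Tendsto (fun m => S (ν m)) atTop (𝓝 S') :=
    (continuous_snd.fst.tendsto _).comp hlim
  have hh : Tendsto (fun m => K.H (i (ν m)) (x (ν m))) atTop (𝓝 h) :=
    (continuous_snd.snd.fst.tendsto _).comp hlim
  have hΘ' : Tendsto (fun m => Θ (ν m)) atTop (𝓝 Θ') :=
    ((continuous_subtype_val.comp continuous_snd.snd.snd).tendsto _).comp hlim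
  have hR : Tendsto (fun m => angleMatrix (Θ (ν m)) 0) atTop (𝓝 (angleMatrix Θ' 0)) := by
    have hc : Continuous fun θ => angleMatrix θ 0 :=
      (LipschitzWith.of_dist_le_mul (K := 1) fun θ θ' => by
        simpa [Real.dist_eq] using dist_angleMatrix_angle_le θ θ' 0).continuous
    exact (hc.tendsto _).comp hΘ'
  have hh' : Tendsto (fun m => K.H (i' (ν m)) (x (ν m))) atTop (𝓝 (angleMatrix Θ' 0 * h)) := by
    refine tendsto_of_tendsto_of_dist (hR.mul hh) ?_
    refine squeeze_zero (fun _ => dist_nonneg) (fun m => ?_)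
      ((tendsto_one_div_add_atTop_nhds_zero_nat (𝕜 := ℝ)).comp hν.tendsto_atTop)
    rw [dist_comm]
    exact hd (ν m)
  have hi_lim : Tendsto (fun m => i (ν m)) atTop atTop :=
    (tendsto_atTop_mono hi tendsto_id).comp hν.tendsto_atTop
  have hi'_lim : Tendsto (fun m => i' (ν m)) atTop atTop :=
    tendsto_atTop_mono (fun m => hii' (ν m)) hi_lim
  have hY' : (x', S') ∈ Y :=
    hcl.mem_of_tendsto (hx'.prodMk_nhds hS') (Eventually.of_forall fun m => hS (ν m))
  -- the stabilizer, read in the frame given by `h * S'`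
  set Γ := (rightStabilizer Y).comap (MulAut.conj (h * S')⁻¹).toMonoidHom with hΓ
  have hmem : ∀ g, g ∈ Γ ↔ S'⁻¹ * (h⁻¹ * g * h * S') ∈ rightStabilizer Y := fun g => by
    rw [hΓ, Subgroup.mem_comap]
    simp [mul_assoc]
  have htop : Γ = ⊤ := by
    refine subgroup_eq_top_of_two_tori (Θ := Θ') (fun t => ?_) ?_ (fun t => ?_)
    · exact (hmem _).2 (inv_mul_mem_rightStabilizer K.cocycle_mul_right hY hY'
        (K.conj_diagSU2_mul_mem hα hcl hmaps (fun m => hS (ν m)) hi_lim hx' hS' hh t))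
    · have := Real.cos_nonpos_of_pi_div_two_le_of_le (x := 2 * Θ')
        (by linarith [Θ'.2.1]) (by linarith [Θ'.2.2])
      rw [Real.sin_sq_eq_half_sub]
      linarith
    · have := inv_mul_mem_rightStabilizer K.cocycle_mul_right hY hY'
        (K.conj_diagSU2_mul_mem hα hcl hmaps (fun m => hS (ν m)) hi'_lim hx' hS' hh' t)
      refine (hmem _).2 ?_
      rw [mul_inv_rev] at this
      simpa only [mul_assoc] using this
  refine (Subgroup.eq_top_iff' _).2 fun g => ?_
  have := (hmem (h * S' * g * (h * S')⁻¹)).1 (htop ▸ Subgroup.mem_top _)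
  have e : S'⁻¹ * (h⁻¹ * (h * S' * g * (h * S')⁻¹) * h * S') = g := by group
  rwa [e] at this

end

theorem isTransitiveMap_cocycle (hα : IsDiophantine α) (hθ : ¬ Summable fun i => |K.θ i|) :
    IsTransitiveMap K.cocycle := by
  obtain ⟨Y, hY⟩ := exists_minimal_isClosed_mapsTo K.cocycle
  have htop := K.rightStabilizer_eq_top hα hθ hY
  obtain ⟨hne, hcl, hmaps⟩ := hY.1
  have huniv : ∀ p, p ∈ Y := by
    rintro ⟨x, S⟩
    obtain ⟨S', hS'⟩ := K.exists_mem_fiber hα hne hcl hmaps x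
    have := (mem_rightStabilizer.1 (htop ▸ Subgroup.mem_top (S'⁻¹ * S)) (x, S')).1 hS'
    simpa using this
  obtain ⟨p, hp⟩ := hne
  refine ⟨p, fun q => ?_⟩
  refine hY.2 (y := closure (Set.range fun n : ℕ => K.cocycle^[n] p))
    ⟨⟨p, subset_closure ⟨0, rfl⟩⟩, isClosed_closure, ?_⟩ (fun q _ => huniv q) (huniv q)
  refine Set.MapsTo.closure ?_ K.continuous_cocycle
  rintro _ ⟨n, rfl⟩
  exact ⟨n + 1, Function.iterate_succ_apply' _ _ _⟩

end KAMNormalForm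

theorem mainTheorem3 (α : ℝ) (hα : IsDiophantine α) (K : KAMNormalForm α)
    (n : ℕ → ℕ) (ε : ℝ) (hε : 0 < ε) (idx : ℕ → ℕ)
    (hreturn : Tendsto (fun l => ((n l * α : ℝ) : UnitAddCircle)) atTop (𝓝 0))
    (hnonreturn : ε ≤ liminf (fun l => |modHalf (n l * K.aInf)|) atTop)
    (hidx : Tendsto idx atTop atTop)
    (hconj : Tendsto (fun l => K.H (idx l) (n l * α) * star (K.prodD (idx l))) atTop (𝓝 1))
    (hF : Tendsto (fun l => (n l : ℝ) * ⨆ x, ‖K.F (idx l + 1) x‖) atTop (𝓝 0))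
    (haccum : ∃ P Q : SO3, P ≠ Q ∧
      MapClusterPt P atTop (fun i => (K.prodD i : SO3)) ∧
      MapClusterPt Q atTop (fun i => (K.prodD i : SO3))) :
    IsTransitiveMap K.cocycle := by
  exact K.isTransitiveMap_cocycle hα (K.not_summable_abs_θ haccum)
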